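/- Let $(W,R)$ be a Coxeter system of type $H_3$ and let $T$ be its set of reflections, i.e. of conjugates of elements of $R$. Let $\ell_T(x)$ be the least number of reflections in a factorization of $x \in W$ into elements of $T$. Write $x \preceq z$ if $z = xy$ with $\ell_T(z)=\ell_T(x)+\ell_T(y)$, and let $[1,w] = \{x \in W : x \preceq w\}$, partially ordered by $\preceq$. The interval group $G([1,w])$ is the group generated by symbols $\boldsymbol{u}$, one for each $u \in [1,w]$, subject to the relations $\boldsymbol{u}\boldsymbol{v}=\boldsymbol{r}$ for all $u,v,r\in[1,w]$ with $uv=r$ and $\ell_T(r)=\ell_T(u)+\ell_T(v)$. A quasi-Coxeter element is an element $w$ having a factorization $w=t_1\cdots t_m$ with $t_i \in T$, $m=\ell_T(w)$ and $\langle t_1,\dots,t_m\rangle=W$; it is proper if it is not a Coxeter element, i.e. not conjugate to a product of all the elements of $R$ in some order. **Theorem.** The proper quasi-Coxeter elements of order $6$ in $W$ form exactly one (non-empty) conjugacy class, denoted $H_3(a_2)$. For each element $w$ of this class the following hold. 1. There are reflections $s_1,s_2,s_3 \in [1,w]$ such that the corresponding elements $\boldsymbol{s}_1,\boldsymbol{s}_2,\boldsymbol{s}_3$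 generate $G([1,w])$, and $G([1,w])$ has the presentation on these three generators with the braid relations of the triangle with edge $\boldsymbol{s}_2\boldsymbol{s}_3$ labelled $5$, namely $$\boldsymbol{s}_1\boldsymbol{s}_2\boldsymbol{s}_1=\boldsymbol{s}_2\boldsymbol{s}_1\boldsymbol{s}_2,\quad \boldsymbol{s}_1\boldsymbol{s}_3\boldsymbol{s}_1=\boldsymbol{s}_3\boldsymbol{s}_1\boldsymbol{s}_3,\quad \boldsymbol{s}_2\boldsymbol{s}_3\boldsymbol{s}_2\boldsymbol{s}_3\boldsymbol{s}_2=\boldsymbol{s}_3\boldsymbol{s}_2\boldsymbol{s}_3\boldsymbol{s}_2\boldsymbol{s}_3,$$ together with the two relations $$\boldsymbol{s}_2\boldsymbol{s}_3\boldsymbol{s}_2\boldsymbol{s}_1\boldsymbol{s}_3\boldsymbol{s}_2=\boldsymbol{s}_3\boldsymbol{s}_2\boldsymbol{s}_1\boldsymbol{s}_3\boldsymbol{s}_2\boldsymbol{s}_3,\qquad (\boldsymbol{s}_3\boldsymbol{s}_2\boldsymbol{s}_1)^3=(\boldsymbol{s}_1\boldsymbol{s}_3\boldsymbol{s}_2)^3.$$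 2. The poset $([1,w],\preceq)$ is a lattice. 3. $G([1,w])$ is a Garside group: it contains a submonoid $N$ such that every element of $G([1,w])$ is of the form $a^{-1}b$ with $a,b\in N$, and such that $N$ is a Garside monoid. The latter means that $N$ is cancellative; that there is $\lambda\colon N\to\mathbb{Z}_{\ge 0}$ with $\lambda(fg)\ge\lambda(f)+\lambda(g)$ and $\lambda(g)\neq 0$ for $g\ne 1$; that any two elements of $N$ have left and right least common multiples and left and right greatest common divisors; and that some $\Delta\in N$ has the same left and right divisors, which are finite in number and generate $N$. 4. $G([1,w])$ is not isomorphic to the Artin group $A(H_3)$. -/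

import Mathlib

namespace CoxeterSystem

variable {B W : Type*} [Group W] {M : CoxeterMatrix B} (cs : CoxeterSystem M W)

/-! ### Reflection length, absolute order, intervals -/

/-- `l` is a factorization of `w` into reflections. -/
def IsReflFactorization (w : W) (l : List W) : Prop :=
  (∀ t ∈ l, cs.IsReflection t) ∧ l.prod = w

/-- The reflection length: the least number of reflections in a factorization of `w`. -/
noncomputable def reflLength (w : W) : ℕ :=
  sInf {k : ℕ | ∃ l : List W, cs.IsReflFactorization w l ∧ l.length = k}

/-- The absolute order: `x` is a left divisor of `w` with respect to the reflection length. -/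
def AbsLE (x w : W) : Prop :=
  ∃ y : W, w = x * y ∧ cs.reflLength w = cs.reflLength x + cs.reflLength y

/-- The interval `[1, w]`: the left divisors of `w`. -/
def Interval (w : W) : Type _ := {x : W // cs.AbsLE x w}

theorem exists_reflFactorization (w : W) : ∃ l : List W, cs.IsReflFactorization w l := by
  obtain ⟨ω, rfl⟩ := cs.wordProd_surjective w
  refine ⟨ω.map cs.simple, ?_, rfl⟩
  intro t ht
  obtain ⟨i, -, rfl⟩ := List.mem_map.1 ht
  exact cs.isReflection_simple i

theorem exists_reduced_reflFactorization (w : W) :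
    ∃ l : List W, cs.IsReflFactorization w l ∧ l.length = cs.reflLength w := by
  obtain ⟨l, hl⟩ := cs.exists_reflFactorization w
  exact Nat.sInf_mem (s := {k : ℕ | ∃ l : List W, cs.IsReflFactorization w l ∧ l.length = k})
    ⟨l.length, l, hl, rfl⟩

theorem reflLength_one : cs.reflLength 1 = 0 :=
  Nat.le_zero.1 (Nat.sInf_le ⟨[], ⟨by simp, by simp⟩, rfl⟩)

theorem eq_one_of_reflLength_eq_zero {w : W} (h : cs.reflLength w = 0) : w = 1 := by
  obtain ⟨l, hl, hk⟩ := cs.exists_reduced_reflFactorization w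
  rw [h, List.length_eq_zero_iff] at hk
  rw [← hl.2, hk, List.prod_nil]

theorem reflLength_mul_le (x y : W) :
    cs.reflLength (x * y) ≤ cs.reflLength x + cs.reflLength y := by
  obtain ⟨l, hl, hk⟩ := cs.exists_reduced_reflFactorization x
  obtain ⟨l', hl', hk'⟩ := cs.exists_reduced_reflFactorization y
  refine Nat.sInf_le ⟨l ++ l', ⟨?_, ?_⟩, ?_⟩
  · intro t ht
    rcases List.mem_append.1 ht with h | h
    exacts [hl.1 t h, hl'.1 t h]
  · rw [List.prod_append, hl.2, hl'.2]
  · rw [List.length_append, hk, hk']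

/-- The absolute order makes the interval `[1, w]` a partially ordered set. -/
instance (w : W) : PartialOrder (cs.Interval w) where
  le x y := cs.AbsLE x.1 y.1
  le_refl x := ⟨1, by simp, by simp [cs.reflLength_one]⟩
  le_trans x y z := by
    rintro ⟨a, ha, hla⟩ ⟨b, hb, hlb⟩
    refine ⟨a * b, by rw [hb, ha, mul_assoc], ?_⟩
    have h1 := cs.reflLength_mul_le a b
    have h2 := cs.reflLength_mul_le x.1 (a * b)
    rw [← mul_assoc, ← ha, ← hb] at h2
    omega
  le_antisymm x y := by
    rintro ⟨a, ha, hla⟩ ⟨b, hb, hlb⟩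
    have h : cs.reflLength a = 0 := by omega
    apply Subtype.ext
    rw [ha, cs.eq_one_of_reflLength_eq_zero h, mul_one]

/-- A Coxeter element: a conjugate of the product of all simple reflections in some order. -/
def IsCoxeterElement (w : W) : Prop :=
  ∃ l : List B, l.Nodup ∧ (∀ i, i ∈ l) ∧ IsConj (cs.wordProd l) w

/-- A quasi-Coxeter element: some reduced reflection factorization of `w` generates `W`. -/
def IsQuasiCoxeter (w : W) : Prop :=
  ∃ l : List W, cs.IsReflFactorization w l ∧ l.length = cs.reflLength w ∧
    Subgroup.closure {t | t ∈ l} = ⊤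

/-- A proper quasi-Coxeter element: quasi-Coxeter, but not a Coxeter element. -/
def IsProperQuasiCoxeter (w : W) : Prop :=
  cs.IsQuasiCoxeter w ∧ ¬ cs.IsCoxeterElement w

/-! ### Interval groups -/

/-- The relators `[u] [v] [r]⁻¹` for `u, v, r ∈ [1, w]` with `u v = r` and
`ℓ(r) = ℓ(u) + ℓ(v)`. -/
def intervalRelators (w : W) : Set (FreeGroup (cs.Interval w)) :=
  {g | ∃ u v r : cs.Interval w, u.1 * v.1 = r.1 ∧
    cs.reflLength r.1 = cs.reflLength u.1 + cs.reflLength v.1 ∧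
    g = FreeGroup.of u * FreeGroup.of v * (FreeGroup.of r)⁻¹}

/-- The interval group `G([1, w])`. -/
abbrev IntervalGroup (w : W) : Type _ := PresentedGroup (cs.intervalRelators w)

end CoxeterSystem

/-! ### Artin groups and the triangle presentation -/

/-- The braid relators of a Coxeter matrix, `⋯ s t s = ⋯ t s t` with `M s t` factors on each side.
An infinite label (encoded by `0`) and the diagonal entries give trivial relators. -/
def CoxeterMatrix.braidRelators {B : Type*} (M : CoxeterMatrix B) : Set (FreeGroup B) :=
  {g | ∃ i j : B, g =
    ((CoxeterSystem.alternatingWord i j (M i j)).map FreeGroup.of).prod *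
      ((CoxeterSystem.alternatingWord j i (M i j)).map FreeGroup.of).prod⁻¹}

/-- The Artin group of a Coxeter matrix. -/
abbrev CoxeterMatrix.ArtinGroup {B : Type*} (M : CoxeterMatrix B) : Type _ :=
  PresentedGroup M.braidRelators

namespace H3a2

/-- The triangle diagram: edges `s₁ s₂` and `s₁ s₃` unlabelled (that is, `3`), edge `s₂ s₃`
labelled `5`. The indices `0, 1, 2` stand for `s₁, s₂, s₃`. -/
def triangle : CoxeterMatrix (Fin 3) where
  M := !![1, 3, 3;
          3, 1, 5;
          3, 5, 1]
  isSymm := by decide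
  diagonal := by decide
  off_diagonal := by
    intro i j h
    fin_cases i <;> fin_cases j <;> simp_all

/-- The free generator `s₁`. -/
def s₁ : FreeGroup (Fin 3) := FreeGroup.of 0

/-- The free generator `s₂`. -/
def s₂ : FreeGroup (Fin 3) := FreeGroup.of 1

/-- The free generator `s₃`. -/
def s₃ : FreeGroup (Fin 3) := FreeGroup.of 2

/-- The braid relators of the triangle together with the relators of
`s₂s₃s₂s₁s₃s₂ = s₃s₂s₁s₃s₂s₃` and `(s₃s₂s₁)³ = (s₁s₃s₂)³`. -/
def relators : Set (FreeGroup (Fin 3)) :=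
  triangle.braidRelators ∪
    {(s₂ * s₃ * s₂ * s₁ * s₃ * s₂) * (s₃ * s₂ * s₁ * s₃ * s₂ * s₃)⁻¹,
      (s₃ * s₂ * s₁) ^ 3 * ((s₁ * s₃ * s₂) ^ 3)⁻¹}

/-- The elements `H₃(a₂)` of a Coxeter group of type `H₃`: the proper quasi-Coxeter elements of
order `6` (the other class of proper quasi-Coxeter elements, `H₃(a₁)`, has order `10`). -/
def IsH3a2 {W : Type*} [Group W] (cs : CoxeterSystem CoxeterMatrix.H₃ W) (w : W) : Prop :=
  cs.IsProperQuasiCoxeter w ∧ orderOf w = 6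

end H3a2

/-! ### Garside groups -/

/-- `(N, Δ)` is a Garside monoid: `N` is cancellative, has a superadditive length function that is
positive off the identity, has left and right lcms and gcds of pairs, and the left and the right
divisors of `Δ` form the same finite set, which generates `N`.
Here `a ∣ b` is left divisibility, `b = a * c`, and `a ∣ᵣ b` is right divisibility, `b = c * a`. -/
structure IsGarsideMonoid {N : Type*} [Monoid N] (Δ : N) : Prop where
  mul_left_cancel : ∀ a b c : N, a * b = a * c → b = c
  mul_right_cancel : ∀ a b c : N, b * a = c * a → b = c
  exists_length : ∃ len : N → ℕ, (∀ a b, len a + len b ≤ len (a * b)) ∧ ∀ a, a ≠ 1 → len a ≠ 0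
  exists_right_lcm : ∀ a b : N, ∃ m, ∀ c, m ∣ c ↔ a ∣ c ∧ b ∣ c
  exists_left_lcm : ∀ a b : N, ∃ m, ∀ c, m ∣ᵣ c ↔ a ∣ᵣ c ∧ b ∣ᵣ c
  exists_left_gcd : ∀ a b : N, ∃ d, ∀ c, c ∣ d ↔ c ∣ a ∧ c ∣ b
  exists_right_gcd : ∀ a b : N, ∃ d, ∀ c, c ∣ᵣ d ↔ c ∣ᵣ a ∧ c ∣ᵣ b
  divisors_eq : {a : N | a ∣ Δ} = {a : N | a ∣ᵣ Δ}
  divisors_finite : {a : N | a ∣ Δ}.Finite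
  divisors_generate : Submonoid.closure {a : N | a ∣ Δ} = ⊤

/-- A Garside group: the group of left fractions of a Garside monoid it contains. -/
def IsGarsideGroup (G : Type*) [Group G] : Prop :=
  ∃ (N : Submonoid G) (Δ : N), IsGarsideMonoid Δ ∧ ∀ g : G, ∃ a b : N, g = (a : G)⁻¹ * (b : G)

/-!
The Coxeter group `W` of type `H₃` is isomorphic to `A₅ × {±1}`, where the reflections are the pairs
of an involution and `-1`. Completing the braid relations shows that `W` has at most `120` elements
(`exists_normalForm`), and their values in `A₅ × {±1}` are all different (`exists_isModel`). In this
model the reflection length is explicit (`reflLength_eq`), and the proper quasi-Coxeter elements of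
order `6` are the pairs of a three-cycle and `-1`, which form one conjugacy class (`isH3a2_iff`).

Let `w` be such an element. The interval `[1, w]` consists of `1`, the `15` reflections, their `15`
complements and `w` (`interval_cases`). Its elements of length two have different rotation axes, so
two different reflections have at most one common upper bound of length two; a graded poset of rank
three with this property is a lattice (`exists_isLUB_of_rank`).

As the interval is a lattice and the reflection length is invariant under conjugation, the interval
is a germ with complements `x \ y = x⁻¹ (x ∨ y)` on both sides (`IsConjLength.isComplemented`). A
complemented germ presents a Garside monoid: the complement operation is compatible with the
relations, so it extends to an action of the whole monoid, and this gives cancellation and least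
common multiples (`Germ.exists_complement`, `Germ.isGarsideMonoid`). By Ore's theorem the monoid
embeds in its group of fractions, hence in the interval group (`isGarsideGroup_intervalGroup`).

The interval group is universal among groups with a dual system, that is, with elements in place of
the reflections and of `w` that satisfy the conjugation relations by `w` and the relations given by
the reduced factorizations of `w`. A dual system is determined by three of its members, which
satisfy the relations of the triangle presentation (`IsDualSystem.eq_dual`,
`IsDualSystem.triangleRelations`). Conversely, these relations make `(v u t) ^ 3` central, so
rotating factorizations reduces the relations of a dual system to those of six factorizations, which
are verified directly (`TriangleRelations.isDualSystem`). This proves the presentation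
(`exists_mulEquiv`).

Finally, `(v u t) ^ 3` is a central element of the interval group that is a product of nine
conjugate generators. The Artin group has a five-dimensional absolutely irreducible representation
over the field with `11` elements, a specialization of a representation of the Hecke algebra. Under
an isomorphism the central element would act by a scalar `a`, and comparing determinants gives
`a ^ 5 = d ^ 9` with `d` of order `10`, whereas `a ^ 10 = 1` (`isEmpty_mulEquiv_artinGroup`).
-/

/-! ### Monoids presented by a germ -/

namespace Germ

universe u

variable {P M : Type u} [Monoid M]

/-- `ι : P → M` exhibits `M` as the monoid presented by the generators `P`, the relations `x y = z`
for `R x y z`, and `e = 1`. The universal property is only asked for in the universe of `P`. -/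
structure IsEnveloping (R : P → P → P → Prop) (e : P) (ι : P → M) : Prop where
  map_one : ι e = 1
  map_mul : ∀ x y z, R x y z → ι x * ι y = ι z
  closure_range : Submonoid.closure (Set.range ι) = ⊤
  exists_lift : ∀ {T : Type u} [Monoid T] (f : P → T), f e = 1 →
    (∀ x y z, R x y z → f x * f y = f z) → ∃ F : M →* T, ∀ x, F (ι x) = f x

/-- A partial multiplication `R x y z`, read `x y = z`, with unit `e` and with a complement:
`c x y` is the element `x \ y` such that `x (x \ y) = y (y \ x)` is the least common right multiple
of `x` and `y`. -/
structure IsComplemented (R : P → P → P → Prop) (e : P) (c : P → P → P) : Prop where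
  self : ∀ x, c x x = e
  one_left : ∀ x, c e x = x
  one_right : ∀ x, c x e = e
  lcm : ∀ x y, ∃ j, R x (c x y) j ∧ R y (c y x) j
  mul_comp : ∀ x y z r, R y z r → c r x = c z (c y x)
  comp_mul : ∀ x y z r, R y z r → R (c x y) (c (c y x) z) (c x r)
  eq_of_mul_one : ∀ x r, R x e r → x = r
  assoc : ∀ x y z q r, R y z q → R x q r → ∃ s, R x y s ∧ R s z r

/-- Transition functions with state space `P` and outputs in `M`. -/
@[ext]
structure Transducer (P M : Type u) : Type u where
  /-- The new state. -/
  state : P → P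
  /-- The output. -/
  out : P → M

/-- Transducers are composed by running the left factor first and multiplying the outputs. -/
instance : Monoid (Transducer P M) where
  mul f g := ⟨fun x => g.state (f.state x), fun x => f.out x * g.out (f.state x)⟩
  one := ⟨fun x => x, fun _ => 1⟩
  mul_assoc f g h := Transducer.ext rfl (funext fun x => mul_assoc _ _ _)
  one_mul f := Transducer.ext rfl (funext fun x => one_mul _)
  mul_one f := Transducer.ext rfl (funext fun x => mul_one _)

theorem Transducer.state_mul (f g : Transducer P M) (x : P) :
    (f * g).state x = g.state (f.state x) := rfl

theorem Transducer.out_mul (f g : Transducer P M) (x : P) :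
    (f * g).out x = f.out x * g.out (f.state x) := rfl

theorem Transducer.state_one (x : P) : (1 : Transducer P M).state x = x := rfl

theorem Transducer.out_one (x : P) : (1 : Transducer P M).out x = 1 := rfl

variable {R : P → P → P → Prop} {e : P} {c : P → P → P} {ι : P → M}

theorem IsEnveloping.induction_left (h : IsEnveloping R e ι) {p : M → Prop} (one : p 1)
    (mul : ∀ x m, p m → p (ι x * m)) (m : M) : p m := by
  have hm : m ∈ Submonoid.closure (Set.range ι) := h.closure_range ▸ Submonoid.mem_top m
  induction hm using Submonoid.closure_induction_left with
  | one => exact one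
  | mul_left x hx y _ hy =>
    obtain ⟨x, rfl⟩ := hx
    exact mul x y hy

theorem IsEnveloping.op (h : IsEnveloping R e ι) :
    IsEnveloping (fun x y z => R y x z) e fun x => MulOpposite.op (ι x) where
  map_one := by rw [h.map_one, MulOpposite.op_one]
  map_mul x y z hr := by rw [← MulOpposite.op_mul, h.map_mul _ _ _ hr]
  closure_range := by
    rw [Submonoid.eq_top_iff']
    intro m
    induction m using MulOpposite.rec' with | _ m
    induction m using h.induction_left with
    | one => exact Submonoid.one_mem _
    | mul x m hm => exact Submonoid.mul_mem _ hm (Submonoid.subset_closure ⟨x, rfl⟩)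
  exists_lift f h1 h2 := by
    obtain ⟨F, hF⟩ := h.exists_lift (fun x => MulOpposite.op (f x)) (by rw [h1, MulOpposite.op_one])
      (fun x y z hr => by rw [← MulOpposite.op_mul, h2 _ _ _ hr])
    exact ⟨⟨⟨fun m => (F m.unop).unop, by simp⟩, fun a b => by simp⟩, fun x => by simp [hF]⟩

theorem IsEnveloping.map {N : Type u} [Monoid N] (h : IsEnveloping R e ι) (φ : M ≃* N) :
    IsEnveloping R e fun x => φ (ι x) where
  map_one := by rw [h.map_one, _root_.map_one]
  map_mul x y z hr := by rw [← _root_.map_mul, h.map_mul _ _ _ hr]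
  closure_range := by
    rw [Submonoid.eq_top_iff']
    intro m
    obtain ⟨m, rfl⟩ := φ.surjective m
    induction m using h.induction_left with
    | one => rw [_root_.map_one]; exact Submonoid.one_mem _
    | mul x m hm =>
      rw [_root_.map_mul]
      exact Submonoid.mul_mem _ (Submonoid.subset_closure ⟨x, rfl⟩) hm
  exists_lift f h1 h2 := by
    obtain ⟨F, hF⟩ := h.exists_lift f h1 h2
    exact ⟨F.comp φ.symm.toMonoidHom, fun x => by simp [hF]⟩

/-- The monoid presented by a partial multiplication exists. -/
theorem exists_isEnveloping (R : P → P → P → Prop) (e : P) :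
    ∃ (M : Type u) (_ : Monoid M) (ι : P → M), IsEnveloping R e ι := by
  let rels : FreeMonoid P → FreeMonoid P → Prop := fun a b =>
    (∃ x y z, R x y z ∧ a = .of x * .of y ∧ b = .of z) ∨ (a = .of e ∧ b = 1)
  refine ⟨PresentedMonoid rels, inferInstance, PresentedMonoid.of rels, ?_, ?_, ?_, ?_⟩
  · exact PresentedMonoid.mk_eq_mk_of_rel (.inr ⟨rfl, rfl⟩)
  · intro x y z hr
    exact PresentedMonoid.mk_eq_mk_of_rel (.inl ⟨x, y, z, hr, rfl, rfl⟩)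
  · exact PresentedMonoid.closure_range_of rels
  · intro T _ f h1 h2
    refine ⟨PresentedMonoid.lift f ?_, fun x => rfl⟩
    rintro _ _ (⟨x, y, z, hr, rfl, rfl⟩ | ⟨rfl, rfl⟩)
    · simpa using h2 x y z hr
    · simpa using h1

/-- The complement `x \ m` and the remainder `m \ x` of a generator `x` and an arbitrary `m : M`
are well defined: letting a generator `y` act by `x ↦ (y \ x, x \ y)` respects the relations, so
it defines a homomorphism from `M` to transducers. -/
theorem exists_complement (h : IsEnveloping R e ι) (hc : IsComplemented R e c) :
    ∃ (rem : M → P → P) (comp : P → M → M),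
      (∀ x, rem 1 x = x) ∧ (∀ x y m, rem (ι y * m) x = rem m (c y x)) ∧ (∀ m, rem m e = e) ∧
      (∀ x y m, comp x (ι y * m) = ι (c x y) * comp (c y x) m) ∧ ∀ m, comp e m = m := by
  obtain ⟨F, hF⟩ := h.exists_lift (T := Transducer P M) (fun y => ⟨c y, fun x => ι (c x y)⟩)
    (Transducer.ext (funext fun x => hc.one_left x)
      (funext fun x => (congrArg ι (hc.one_right x)).trans h.map_one))
    (fun y z r hr => Transducer.ext (funext fun x => (hc.mul_comp x y z r hr).symm)
      (funext fun x => h.map_mul _ _ _ (hc.comp_mul x y z r hr)))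
  have h2 : ∀ x y m, (F (ι y * m)).state x = (F m).state (c y x) := fun x y m => by
    rw [_root_.map_mul, Transducer.state_mul, hF]
  have h4 : ∀ x y m, (F (ι y * m)).out x = ι (c x y) * (F m).out (c y x) := fun x y m => by
    rw [_root_.map_mul, Transducer.out_mul, hF]
  refine ⟨fun m x => (F m).state x, fun x m => (F m).out x, fun x => ?_, h2, fun m => ?_, h4,
    fun m => ?_⟩
  · beta_reduce
    rw [map_one, Transducer.state_one]
  · beta_reduce
    induction m using h.induction_left with
    | one => rw [map_one, Transducer.state_one]
    | mul y m hm => rw [h2, hc.one_right, hm]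
  · beta_reduce
    induction m using h.induction_left with
    | one => rw [map_one, Transducer.out_one]
    | mul y m hm => rw [h4, hc.one_left, hc.one_right, hm]

theorem mul_left_cancel_generator (h : IsEnveloping R e ι) (hc : IsComplemented R e c) {x : P}
    {m n : M} (hmn : ι x * m = ι x * n) : m = n := by
  obtain ⟨rem, comp, -, -, -, h2, key⟩ := exists_complement h hc
  have := congrArg (comp x) hmn
  simpa only [h2, hc.self, h.map_one, one_mul, key] using this

theorem mul_left_cancel (h : IsEnveloping R e ι) (hc : IsComplemented R e c) (a : M) :
    ∀ {m n : M}, a * m = a * n → m = n := by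
  induction a using h.induction_left with
  | one => simp
  | mul x a ha =>
    intro m n hmn
    rw [mul_assoc, mul_assoc] at hmn
    exact ha (mul_left_cancel_generator h hc hmn)

/-- A generator and an arbitrary element have a least common right multiple `x (x \ m)`. -/
theorem exists_lcm_generator (h : IsEnveloping R e ι) (hc : IsComplemented R e c) (m : M) :
    ∀ x : P, ∃ l, ∀ k, l ∣ k ↔ ι x ∣ k ∧ m ∣ k := by
  induction m using h.induction_left with
  | one => exact fun x => ⟨ι x, by simp⟩
  | mul y m hm =>
    intro x
    obtain ⟨l, hl⟩ := hm (c y x)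
    obtain ⟨j, hj1, hj2⟩ := hc.lcm x y
    have hj := (h.map_mul _ _ _ hj1).trans (h.map_mul _ _ _ hj2).symm
    refine ⟨ι y * l, fun k => ⟨?_, ?_⟩⟩
    · rintro ⟨k, rfl⟩
      refine ⟨?_, ?_⟩
      · obtain ⟨d, hd⟩ := ((hl l).1 dvd_rfl).1
        rw [hd, ← mul_assoc (ι y), ← hj, mul_assoc, mul_assoc]
        exact dvd_mul_right _ _
      · exact (mul_dvd_mul_left _ ((hl l).1 dvd_rfl).2).trans (dvd_mul_right _ _)
    · rintro ⟨⟨a, ha⟩, ⟨b, rfl⟩⟩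
      rw [mul_assoc] at ha ⊢
      refine mul_dvd_mul_left _ ((hl _).2 ⟨?_, dvd_mul_right _ _⟩)
      -- `y \ (x a) = (y \ x) ((x \ y) \ a)`, whereas `y \ (y m b) = m b`.
      obtain ⟨rem, comp, -, -, -, h2, key⟩ := exists_complement h hc
      have hy := congrArg (comp y) ha
      simp only [h2, hc.self, h.map_one, one_mul, key] at hy
      rw [hy]
      exact dvd_mul_right _ _

theorem exists_lcm (h : IsEnveloping R e ι) (hc : IsComplemented R e c) (a : M) :
    ∀ b : M, ∃ l, ∀ k, l ∣ k ↔ a ∣ k ∧ b ∣ k := by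
  induction a using h.induction_left with
  | one => exact fun b => ⟨b, by simp⟩
  | mul x a ha =>
    intro b
    obtain ⟨l, hl⟩ := exists_lcm_generator h hc b x
    obtain ⟨d, rfl⟩ := ((hl l).1 dvd_rfl).1
    obtain ⟨n, hn⟩ := ha d
    refine ⟨ι x * n, fun k => ⟨fun hk => ⟨?_, ?_⟩, ?_⟩⟩
    · exact (mul_dvd_mul_left _ ((hn n).1 dvd_rfl).1).trans hk
    · exact ((hl _).1 (mul_dvd_mul_left _ ((hn n).1 dvd_rfl).2)).2.trans hk
    · rintro ⟨⟨k, rfl⟩, hb⟩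
      obtain ⟨q, hq⟩ := (hl (ι x * a * k)).2 ⟨⟨a * k, mul_assoc _ _ _⟩, hb⟩
      rw [mul_assoc, mul_assoc] at hq
      rw [mul_assoc]
      refine mul_dvd_mul_left _ ((hn _).2 ⟨dvd_mul_right _ _, ?_⟩)
      rw [mul_left_cancel_generator h hc hq]
      exact dvd_mul_right _ _

/-- Every factorization in `M` of a generator comes from the partial multiplication. -/
theorem exists_of_mul_eq_generator (h : IsEnveloping R e ι) (hc : IsComplemented R e c) (a : M) :
    ∀ (b : M) (r : P), a * b = ι r → ∃ x y, a = ι x ∧ b = ι y ∧ R x y r := by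
  have mul_one : ∀ x, R x e x := fun x => by
    obtain ⟨j, hj, -⟩ := hc.lcm x x
    rw [hc.self] at hj
    rwa [← hc.eq_of_mul_one x j hj] at hj
  have one_mul' : ∀ x, R e x x := fun x => by
    obtain ⟨j, hj, hj'⟩ := hc.lcm e x
    rw [hc.one_left] at hj
    rw [hc.one_right] at hj'
    rwa [← hc.eq_of_mul_one x j hj'] at hj
  induction a using h.induction_left with
  | one =>
    intro b r hb
    exact ⟨e, r, h.map_one.symm, by rwa [one_mul] at hb, one_mul' r⟩
  | mul y a ha =>
    intro b r hb
    obtain ⟨rem, -, h1, h3, key, -⟩ := exists_complement h hc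
    -- The remainder of `y` after division by `r = y a b` is trivial, so `y` divides `r` in `P`.
    have hrem : c r y = e := by
      have := congrArg (fun t => rem t y) hb
      rw [← _root_.mul_one (ι r), mul_assoc] at this
      simpa only [h3, hc.self, key, h1] using this.symm
    obtain ⟨j, hj1, hj2⟩ := hc.lcm y r
    rw [hrem] at hj2
    obtain rfl := hc.eq_of_mul_one _ _ hj2
    rw [← h.map_mul _ _ _ hj1, mul_assoc] at hb
    obtain ⟨x, z, rfl, rfl, hxz⟩ := ha b _ (mul_left_cancel_generator h hc hb)
    obtain ⟨s, hs1, hs2⟩ := hc.assoc _ _ _ _ _ hxz hj1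
    exact ⟨s, z, h.map_mul _ _ _ hs1, rfl, hs2⟩

/-- A monoid with an additive length that is positive off the identity and with least common right
multiples has greatest common left divisors: a common divisor of maximal length is divisible by
every other one. -/
theorem exists_gcd_of_lcm (len : M → ℕ) (len_mul : ∀ a b, len (a * b) = len a + len b)
    (len_eq : ∀ a, len a = 0 → a = 1) (lcm : ∀ a b : M, ∃ l, ∀ k, l ∣ k ↔ a ∣ k ∧ b ∣ k)
    (a b : M) : ∃ d, ∀ k, k ∣ d ↔ k ∣ a ∧ k ∣ b := by
  have bdd : BddAbove (len '' {d | d ∣ a ∧ d ∣ b}) := by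
    refine ⟨len a, ?_⟩
    rintro _ ⟨d, ⟨⟨q, rfl⟩, -⟩, rfl⟩
    rw [len_mul]
    exact Nat.le_add_right _ _
  obtain ⟨d, hd, hmax⟩ := Nat.sSup_mem (s := len '' {d | d ∣ a ∧ d ∣ b})
    ⟨_, 1, ⟨one_dvd _, one_dvd _⟩, rfl⟩ bdd
  refine ⟨d, fun k => ⟨fun hk => ⟨hk.trans hd.1, hk.trans hd.2⟩, fun hk => ?_⟩⟩
  obtain ⟨l, hl⟩ := lcm k d
  obtain ⟨q, hq⟩ := ((hl l).1 dvd_rfl).2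
  have hle : len l ≤ len d := by
    rw [hmax]
    exact le_csSup bdd ⟨l, ⟨(hl a).2 ⟨hk.1, hd.1⟩, (hl b).2 ⟨hk.2, hd.2⟩⟩, rfl⟩
  rw [hq, len_mul] at hle
  rw [len_eq q (by omega), mul_one] at hq
  exact hq ▸ ((hl l).1 dvd_rfl).1

/-- A finite germ that is complemented on both sides, with a length and a greatest element `δ`,
presents a Garside monoid. -/
theorem isGarsideMonoid [Finite P] (h : IsEnveloping R e ι) (hc : IsComplemented R e c)
    {c' : P → P → P} (hc' : IsComplemented (fun x y z => R y x z) e c') (ℓ : P → ℕ)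
    (hℓ : ∀ x y z, R x y z → ℓ z = ℓ x + ℓ y) (hℓ1 : ∀ x, ℓ x = 0 → x = e) (δ : P)
    (hδ : ∀ x, ∃ y, R x y δ) (hδ' : ∀ x, ∃ y, R y x δ) : IsGarsideMonoid (ι δ) := by
  have hℓe : ℓ e = 0 := by
    obtain ⟨j, hj, -⟩ := hc.lcm e e
    rw [hc.self] at hj
    have := hℓ _ _ _ hj
    rw [← hc.eq_of_mul_one _ _ hj] at this
    omega
  obtain ⟨L, hL⟩ := h.exists_lift (T := ULift (Multiplicative ℕ))
    (fun x => ⟨Multiplicative.ofAdd (ℓ x)⟩) (by rw [hℓe]; rfl)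
    (fun x y z hr => by rw [hℓ x y z hr]; rfl)
  let len : M → ℕ := fun m => Multiplicative.toAdd (L m).down
  have len_one : len 1 = 0 := by simp only [len, map_one]; rfl
  have len_mul : ∀ a b, len (a * b) = len a + len b := fun a b => by
    simp only [len, map_mul]; rfl
  have len_ι : ∀ x, len (ι x) = ℓ x := fun x => by simp only [len, hL]; rfl
  have len_eq : ∀ a, len a = 0 → a = 1 := fun a => by
    induction a using h.induction_left with
    | one => exact fun _ => rfl
    | mul x a ha =>
      intro h0
      rw [len_mul, len_ι] at h0
      rw [hℓ1 x (by omega), ha (by omega), h.map_one, mul_one]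
  have lcm' : ∀ a b : Mᵐᵒᵖ, ∃ l, ∀ k, l ∣ k ↔ a ∣ k ∧ b ∣ k := exists_lcm h.op hc'
  have gcd' := exists_gcd_of_lcm (M := Mᵐᵒᵖ) (fun a => len a.unop)
    (fun a b => by rw [MulOpposite.unop_mul, len_mul, add_comm])
    (fun a ha => MulOpposite.unop_injective (len_eq _ ha)) lcm'
  have div : {a : M | a ∣ ι δ} = Set.range ι := by
    ext a
    refine ⟨?_, ?_⟩
    · rintro ⟨b, hb⟩
      obtain ⟨x, y, rfl, -⟩ := exists_of_mul_eq_generator h hc a b δ hb.symm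
      exact ⟨x, rfl⟩
    · rintro ⟨x, rfl⟩
      obtain ⟨y, hy⟩ := hδ x
      exact ⟨ι y, (h.map_mul _ _ _ hy).symm⟩
  have div' : {a : M | a ∣ᵣ ι δ} = Set.range ι := by
    ext a
    refine ⟨?_, ?_⟩
    · rintro ⟨b, hb⟩
      obtain ⟨x, y, -, rfl, -⟩ := exists_of_mul_eq_generator h hc b a δ hb.symm
      exact ⟨y, rfl⟩
    · rintro ⟨x, rfl⟩
      obtain ⟨y, hy⟩ := hδ' x
      exact ⟨ι y, (h.map_mul _ _ _ hy).symm⟩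
  refine ⟨fun a b b' => mul_left_cancel h hc a, fun a b b' hb => ?_,
    ⟨len, fun a b => (len_mul a b).ge, fun a ha h0 => ha (len_eq a h0)⟩, exists_lcm h hc,
    fun a b => ?_, exists_gcd_of_lcm len len_mul len_eq (exists_lcm h hc), fun a b => ?_,
    div.trans div'.symm, div ▸ Set.finite_range ι, div ▸ h.closure_range⟩
  · exact MulOpposite.op_injective (mul_left_cancel h.op hc' (MulOpposite.op a)
      (by rw [← MulOpposite.op_mul, ← MulOpposite.op_mul, hb]))
  · obtain ⟨l, hl⟩ := lcm' (.op a) (.op b)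
    exact ⟨l.unop, fun k => by simpa only [rightDvd_iff_op_dvd_op, MulOpposite.op_unop] using hl _⟩
  · obtain ⟨l, hl⟩ := gcd' (.op a) (.op b)
    exact ⟨l.unop, fun k => by simpa only [rightDvd_iff_op_dvd_op, MulOpposite.op_unop] using hl _⟩

/-- A cancellative monoid with common left multiples embeds in a group. -/
theorem exists_injective_hom_group (hl : ∀ a b c : M, a * b = a * c → b = c)
    (hr : ∀ a b c : M, b * a = c * a → b = c) (ore : ∀ a b : M, ∃ c d, c * a = d * b) :
    ∃ (Γ : Type u) (_ : Group Γ) (f : M →* Γ), Function.Injective f := by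
  choose den num hore using ore
  let _ : OreLocalization.OreSet (⊤ : Submonoid M) :=
    { ore_right_cancel := fun a b s hs => ⟨1, by rw [hr _ _ _ hs]⟩
      oreNum := fun r s => num r s
      oreDenom := fun r s => ⟨den r s, trivial⟩
      ore_eq := fun r s => hore r s }
  refine ⟨(OreLocalization (⊤ : Submonoid M) M)ˣ, inferInstance,
    ⟨⟨fun m => OreLocalization.numeratorUnit ⟨m, trivial⟩, ?_⟩, ?_⟩, ?_⟩
  · exact Units.ext (map_one (OreLocalization.numeratorHom (S := (⊤ : Submonoid M))))
  · exact fun a b =>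
      Units.ext (map_mul (OreLocalization.numeratorHom (S := (⊤ : Submonoid M))) a b)
  · intro a b hab
    obtain ⟨s, v, h1, h2⟩ := OreLocalization.oreDiv_eq_iff.1 (congrArg Units.val hab)
    simp only [Submonoid.coe_one, mul_one] at h2
    subst h2
    exact (hl _ _ _ h1).symm

end Germ

/-! ### Lattice intervals for a conjugation invariant length -/

/-- A length function on a group that is invariant under conjugation. -/
structure IsConjLength {W : Type*} [Group W] (ℓ : W → ℕ) : Prop where
  eq_zero : ∀ x, ℓ x = 0 ↔ x = 1
  mul_le : ∀ x y, ℓ (x * y) ≤ ℓ x + ℓ y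
  conj : ∀ g x, ℓ (g * x * g⁻¹) = ℓ x

/-- The partial order `x ≼ z` of left divisors attached to a length function. -/
def LengthLE {W : Type*} [Group W] (ℓ : W → ℕ) (x z : W) : Prop := ℓ z = ℓ x + ℓ (x⁻¹ * z)

namespace IsConjLength

variable {W : Type*} [Group W] {ℓ : W → ℕ}

theorem op (h : IsConjLength ℓ) : IsConjLength fun x : Wᵐᵒᵖ => ℓ x.unop where
  eq_zero x := by rw [h.eq_zero, MulOpposite.unop_eq_one_iff]
  mul_le x y := by rw [MulOpposite.unop_mul, add_comm]; exact h.mul_le _ _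
  conj g x := by
    have := h.conj g.unop⁻¹ x.unop
    rwa [inv_inv, mul_assoc] at this

theorem lengthLE_op (h : IsConjLength ℓ) (x z : W) :
    LengthLE (fun x : Wᵐᵒᵖ => ℓ x.unop) (.op x) (.op z) ↔ LengthLE ℓ x z := by
  have := h.conj x (x⁻¹ * z)
  rw [mul_inv_cancel_left] at this
  change ℓ z = ℓ x + ℓ (z * x⁻¹) ↔ _
  rw [this, LengthLE]

theorem one (h : IsConjLength ℓ) : ℓ 1 = 0 := (h.eq_zero 1).2 rfl

theorem refl (h : IsConjLength ℓ) (x : W) : LengthLE ℓ x x := by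
  rw [LengthLE, inv_mul_cancel, h.one, add_zero]

theorem antisymm (h : IsConjLength ℓ) {x y : W} (hxy : LengthLE ℓ x y) (hyx : LengthLE ℓ y x) :
    x = y := by
  unfold LengthLE at *
  have : ℓ (x⁻¹ * y) = 0 := by omega
  rw [h.eq_zero] at this
  exact inv_mul_eq_one.1 this

/-- Lengths add up along every chain between comparable elements. -/
theorem trans_add (h : IsConjLength ℓ) {x y z : W} (hxy : LengthLE ℓ x y) (hyz : LengthLE ℓ y z) :
    LengthLE ℓ x z ∧ ℓ (x⁻¹ * z) = ℓ (x⁻¹ * y) + ℓ (y⁻¹ * z) := by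
  unfold LengthLE at *
  have h1 := h.mul_le x (x⁻¹ * z)
  have h2 := h.mul_le (x⁻¹ * y) (y⁻¹ * z)
  rw [mul_inv_cancel_left] at h1
  rw [mul_assoc, mul_inv_cancel_left] at h2
  omega

theorem trans (h : IsConjLength ℓ) {x y z : W} (hxy : LengthLE ℓ x y) (hyz : LengthLE ℓ y z) :
    LengthLE ℓ x z := (h.trans_add hxy hyz).1

/-- Since `ℓ` is invariant under conjugation, the complement of a divisor is again a divisor. -/
theorem inv_mul_le (h : IsConjLength ℓ) {x z : W} (hxz : LengthLE ℓ x z) :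
    LengthLE ℓ (x⁻¹ * z) z := by
  have := h.conj z⁻¹ x
  unfold LengthLE at *
  rw [mul_inv_rev, inv_inv]
  rw [inv_inv] at this
  omega

theorem le_of_mul {x y : W} (hxy : ℓ (x * y) = ℓ x + ℓ y) : LengthLE ℓ x (x * y) := by
  rwa [LengthLE, inv_mul_cancel_left]

/-- Left translation by the inverse of a common lower bound preserves the order. -/
theorem translate {x y z : W} (hxy : LengthLE ℓ x y) (hxz : LengthLE ℓ x z) :
    LengthLE ℓ (x⁻¹ * y) (x⁻¹ * z) ↔ LengthLE ℓ y z := by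
  unfold LengthLE at *
  rw [mul_inv_rev, inv_inv, mul_assoc, mul_inv_cancel_left]
  omega

/-- An element below `x⁻¹ z` may be multiplied by `x` on the left. -/
theorem mul_le_of_le_inv_mul (h : IsConjLength ℓ) {x y z : W} (hxz : LengthLE ℓ x z)
    (hy : LengthLE ℓ y (x⁻¹ * z)) :
    ℓ (x * y) = ℓ x + ℓ y ∧ LengthLE ℓ (x * y) z := by
  unfold LengthLE at *
  have h1 := h.mul_le x y
  have h2 := h.mul_le (x * y) ((x * y)⁻¹ * z)
  rw [mul_inv_cancel_left] at h2
  rw [mul_inv_rev, mul_assoc] at h2 ⊢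
  omega

/-- If the divisors of `w` have joins, then they form a complemented germ with
`x \ y = x⁻¹ (x ∨ y)`. -/
theorem isComplemented {P : Type*} (h : IsConjLength ℓ) (w : W) (v : P → W)
    (inj : Function.Injective v) (range : ∀ x, (∃ p, v p = x) ↔ LengthLE ℓ x w) (e : P)
    (he : v e = 1) (join : P → P → P)
    (hjoin : ∀ x y z, LengthLE ℓ (v (join x y)) (v z) ↔
      LengthLE ℓ (v x) (v z) ∧ LengthLE ℓ (v y) (v z)) :
    ∃ c, Germ.IsComplemented
      (fun x y z => v x * v y = v z ∧ ℓ (v z) = ℓ (v x) + ℓ (v y)) e c := by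
  have le_w : ∀ p, LengthLE ℓ (v p) w := fun p => (range _).1 ⟨p, rfl⟩
  have left : ∀ x y, LengthLE ℓ (v x) (v (join x y)) := fun x y =>
    ((hjoin x y _).1 (h.refl _)).1
  have right : ∀ x y, LengthLE ℓ (v y) (v (join x y)) := fun x y =>
    ((hjoin x y _).1 (h.refl _)).2
  have comm : ∀ x y, join x y = join y x := fun x y =>
    inj (h.antisymm ((hjoin _ _ _).2 ⟨right _ _, left _ _⟩) ((hjoin _ _ _).2 ⟨right _ _, left _ _⟩))
  have of_le : ∀ x y, LengthLE ℓ (v x) (v y) → join x y = y := fun x y hxy =>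
    inj (h.antisymm ((hjoin _ _ _).2 ⟨hxy, h.refl _⟩) (right _ _))
  have one_le : ∀ x, LengthLE ℓ 1 x := fun x => by
    rw [LengthLE, h.one, inv_one, one_mul, zero_add]
  have hc : ∀ x y, ∃ p, v p = (v x)⁻¹ * v (join x y) := fun x y =>
    (range _).2 (h.trans (h.inv_mul_le (left x y)) (le_w _))
  choose c hc using hc
  -- Left translation by `y` identifies the join of `z` and `y \ x` with that of `y z` and `x`.
  have key : ∀ x y z r, v y * v z = v r → ℓ (v r) = ℓ (v y) + ℓ (v z) →
      v y * v (join z (c y x)) = v (join r x) := by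
    intro x y z r hr hl
    have hyr : LengthLE ℓ (v y) (v r) := by rw [← hr] at hl ⊢; exact le_of_mul hl
    have hys : LengthLE ℓ (v y) (v (join r x)) := h.trans hyr (left _ _)
    obtain ⟨q, hq⟩ := (range _).2 (h.trans (h.inv_mul_le hys) (le_w _))
    have hz : v z = (v y)⁻¹ * v r := by rw [← hr, inv_mul_cancel_left]
    have h1 : LengthLE ℓ (v (join z (c y x))) ((v y)⁻¹ * v (join r x)) := by
      rw [← hq, hjoin, hq, hz, hc]
      exact ⟨(translate hyr hys).2 (left _ _),
        (translate (left _ _) hys).2 ((hjoin _ _ _).2 ⟨hys, right _ _⟩)⟩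
    obtain ⟨hadd, hle⟩ := h.mul_le_of_le_inv_mul hys h1
    obtain ⟨p, hp⟩ := (range _).2 (h.trans hle (le_w _))
    refine h.antisymm hle ?_
    have hyp : LengthLE ℓ (v y) (v p) := hp ▸ le_of_mul hadd
    have hpj : v (join z (c y x)) = (v y)⁻¹ * v p := by rw [hp, inv_mul_cancel_left]
    rw [← hp, hjoin]
    constructor
    · rw [← translate hyr hyp, ← hz, ← hpj]
      exact left _ _
    · refine h.trans (right y x) ?_
      rw [← translate (left _ _) hyp, ← hpj, ← hc]
      exact right _ _
  refine ⟨c, ⟨fun x => ?_, fun x => ?_, fun x => ?_, fun x y => ⟨join x y, ⟨?_, ?_⟩, ?_, ?_⟩, ?_, ?_,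
    ?_, ?_⟩⟩
  · exact inj (by rw [hc, of_le _ _ (h.refl _), inv_mul_cancel, he])
  · exact inj (by rw [hc, of_le _ _ (he ▸ one_le _), he, inv_one, one_mul])
  · exact inj (by rw [hc, comm, of_le _ _ (he ▸ one_le _), inv_mul_cancel, he])
  · rw [hc, mul_inv_cancel_left]
  · rw [hc]
    exact left x y
  · rw [hc, mul_inv_cancel_left, comm]
  · rw [hc, comm x y]
    exact left y x
  · rintro x y z r ⟨hr, hl⟩
    refine inj ?_
    rw [hc, hc, ← key x y z r hr hl, ← hr, mul_inv_rev, mul_assoc, inv_mul_cancel_left]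
  · rintro x y z r ⟨hr, hl⟩
    have hyr : LengthLE ℓ (v y) (v r) := by rw [← hr] at hl ⊢; exact le_of_mul hl
    have h1 : v (c (c y x) z) = (v (join x y))⁻¹ * v (join x r) := by
      rw [hc, hc, comm x r, ← key x y z r hr hl, mul_inv_rev, inv_inv, mul_assoc, comm z,
        comm x y]
    rw [h1, hc, hc]
    refine ⟨by group, (h.trans_add (left x y) ?_).2⟩
    exact (hjoin _ _ _).2 ⟨left _ _, h.trans hyr (right _ _)⟩
  · rintro x r ⟨hr, -⟩
    exact inj (by rwa [he, mul_one] at hr)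
  · rintro x y z q r ⟨hq, hlq⟩ ⟨hr, hlr⟩
    have h1 : LengthLE ℓ (v y) (v q) := by rw [← hq] at hlq ⊢; exact le_of_mul hlq
    have h2 : LengthLE ℓ (v x) (v r) := by rw [← hr] at hlr ⊢; exact le_of_mul hlr
    obtain ⟨hadd, hle⟩ := h.mul_le_of_le_inv_mul (y := v y) h2
      (by rwa [← hr, inv_mul_cancel_left])
    obtain ⟨s, hs⟩ := (range _).2 (h.trans hle (le_w _))
    exact ⟨s, ⟨hs.symm, hs ▸ hadd⟩, by rw [hs, mul_assoc, hq, hr], by rw [hs, hadd]; omega⟩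

end IsConjLength

namespace CoxeterSystem

variable {B W : Type*} [Group W] {M : CoxeterMatrix B} (cs : CoxeterSystem M W)

theorem reflLength_conj_le (g x : W) : cs.reflLength (g * x * g⁻¹) ≤ cs.reflLength x := by
  obtain ⟨l, hl, hk⟩ := cs.exists_reduced_reflFactorization x
  refine Nat.sInf_le ⟨l.map (MulAut.conj g), ⟨?_, ?_⟩, by rw [List.length_map, hk]⟩
  · intro r hr
    obtain ⟨t, ht, rfl⟩ := List.mem_map.1 hr
    exact (hl.1 t ht).conj g
  · rw [← map_list_prod, hl.2, MulAut.conj_apply]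

theorem isConjLength_reflLength : IsConjLength cs.reflLength where
  eq_zero x := ⟨cs.eq_one_of_reflLength_eq_zero, fun h => h ▸ cs.reflLength_one⟩
  mul_le := cs.reflLength_mul_le
  conj g x := by
    refine (cs.reflLength_conj_le g x).antisymm ?_
    have := cs.reflLength_conj_le g⁻¹ (g * x * g⁻¹)
    rwa [show g⁻¹ * (g * x * g⁻¹) * g⁻¹⁻¹ = x by group] at this

theorem absLE_iff (x z : W) : cs.AbsLE x z ↔ LengthLE cs.reflLength x z := by
  refine ⟨?_, fun h => ⟨x⁻¹ * z, (mul_inv_cancel_left _ _).symm, h⟩⟩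
  rintro ⟨y, rfl, h⟩
  exact IsConjLength.le_of_mul h

theorem of_mul_of {w : W} {x y z : cs.Interval w} (h : x.1 * y.1 = z.1)
    (hl : cs.reflLength z.1 = cs.reflLength x.1 + cs.reflLength y.1) :
    (PresentedGroup.of x * PresentedGroup.of y : cs.IntervalGroup w) = PresentedGroup.of z := by
  rw [← mul_inv_eq_one]
  exact PresentedGroup.one_of_mem (rels := cs.intervalRelators w) ⟨x, y, z, h, hl, rfl⟩

/-- The interval group of a lattice interval is a Garside group: the interval is a complemented
germ, on both sides because the reflection length is invariant under conjugation, and the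
cancellative monoid it presents embeds in its group of fractions. -/
theorem isGarsideGroup_intervalGroup (w : W) [Finite (cs.Interval w)]
    (hlat : ∀ x y : cs.Interval w, ∃ z, IsLUB {x, y} z) :
    IsGarsideGroup (cs.IntervalGroup w) := by
  have hℓ := cs.isConjLength_reflLength
  choose join hjoin using hlat
  have hjoin : ∀ x y z : cs.Interval w, LengthLE cs.reflLength (join x y).1 z.1 ↔
      LengthLE cs.reflLength x.1 z.1 ∧ LengthLE cs.reflLength y.1 z.1 := fun x y z => by
    simp only [← absLE_iff]
    have := isLUB_le_iff (b := z) (hjoin x y)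
    simp only [upperBounds_insert, upperBounds_singleton, Set.mem_inter_iff, Set.mem_Ici] at this
    exact this
  let e : cs.Interval w :=
    ⟨1, (cs.absLE_iff _ _).2 (by rw [LengthLE, hℓ.one, inv_one, one_mul, zero_add])⟩
  let δ : cs.Interval w := ⟨w, (cs.absLE_iff _ _).2 (hℓ.refl w)⟩
  let R : cs.Interval w → cs.Interval w → cs.Interval w → Prop := fun x y z =>
    x.1 * y.1 = z.1 ∧ cs.reflLength z.1 = cs.reflLength x.1 + cs.reflLength y.1
  have mem : ∀ x, (∃ p : cs.Interval w, p.1 = x) ↔ LengthLE cs.reflLength x w := fun x => by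
    rw [← absLE_iff]
    exact ⟨fun ⟨p, hp⟩ => hp ▸ p.2, fun h => ⟨⟨x, h⟩, rfl⟩⟩
  obtain ⟨c, hc⟩ : ∃ c, Germ.IsComplemented R e c :=
    hℓ.isComplemented w Subtype.val Subtype.val_injective mem e rfl join hjoin
  obtain ⟨c', hc'⟩ : ∃ c, Germ.IsComplemented (fun x y z => R y x z) e c := by
    obtain ⟨c', hc'⟩ := hℓ.op.isComplemented (.op w) (fun x : cs.Interval w => .op x.1)
      (fun x y hxy => Subtype.ext (MulOpposite.op_injective hxy))
      (fun x => by
        rw [← MulOpposite.op_unop x, hℓ.lengthLE_op, ← mem]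
        exact exists_congr fun p => MulOpposite.op_injective.eq_iff)
      e rfl join (fun x y z => by simp only [hℓ.lengthLE_op, hjoin])
    have hR : (fun x y z => R y x z) = fun x y z : cs.Interval w =>
        MulOpposite.op x.1 * MulOpposite.op y.1 = MulOpposite.op z.1 ∧
          cs.reflLength z.1 = cs.reflLength x.1 + cs.reflLength y.1 := by
      funext x y z
      simp only [R, ← MulOpposite.op_mul, MulOpposite.op_injective.eq_iff,
        add_comm (cs.reflLength y.1)]
    exact ⟨c', hR ▸ hc'⟩
  have hδ : ∀ x, ∃ y, R x y δ := fun x => by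
    have hx := (mem _).1 ⟨x, rfl⟩
    obtain ⟨y, hy⟩ := (mem _).2 (hℓ.inv_mul_le hx)
    exact ⟨y, by rw [hy, mul_inv_cancel_left], by rw [hy]; exact hx⟩
  have hδ' : ∀ x, ∃ y, R y x δ := fun x => by
    have hx := (mem _).1 ⟨x, rfl⟩
    have hconj := hℓ.conj x.1 (x.1⁻¹ * w)
    rw [mul_inv_cancel_left] at hconj
    have hx' : cs.reflLength w = cs.reflLength (w * x.1⁻¹) + cs.reflLength x.1 := by
      rw [hconj, add_comm]
      exact hx
    obtain ⟨y, hy⟩ := (mem (w * x.1⁻¹)).2 (by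
      have := IsConjLength.le_of_mul (ℓ := cs.reflLength) (x := w * x.1⁻¹) (y := x.1)
      rw [inv_mul_cancel_right] at this
      exact this hx')
    exact ⟨y, by rw [hy, inv_mul_cancel_right], by rw [hy]; exact hx'⟩
  obtain ⟨N, _, ι, hι⟩ := Germ.exists_isEnveloping R e
  have garside : ∀ {N : Type _} [Monoid N] {ι : cs.Interval w → N}, Germ.IsEnveloping R e ι →
      IsGarsideMonoid (ι δ) := fun h =>
    Germ.isGarsideMonoid h hc hc' (fun x => cs.reflLength x.1) (fun x y z hr => hr.2)
      (fun x hx => Subtype.ext ((hℓ.eq_zero _).1 hx)) δ hδ hδ'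
  have hN := garside hι
  have ore : ∀ a b : N, ∃ c d, c * a = d * b := fun a b => by
    obtain ⟨m, hm⟩ := hN.exists_left_lcm a b
    obtain ⟨⟨c, hc⟩, d, hd⟩ := (hm m).1 (RightDvd.refl m)
    exact ⟨c, d, hc.symm.trans hd⟩
  have of_e : (PresentedGroup.of e : cs.IntervalGroup w) = 1 := by
    have : (PresentedGroup.of e * PresentedGroup.of e : cs.IntervalGroup w) = PresentedGroup.of e :=
      cs.of_mul_of (one_mul _) (by rw [show cs.reflLength e.1 = 0 from hℓ.one])
    rwa [mul_eq_left] at this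
  obtain ⟨F, hF⟩ := hι.exists_lift (T := cs.IntervalGroup w) PresentedGroup.of of_e
    fun x y z hr => cs.of_mul_of hr.1 hr.2
  -- The monoid maps injectively to the interval group because it embeds in some group.
  have hinj : Function.Injective F := by
    obtain ⟨Γ, _, f, hf⟩ := Germ.exists_injective_hom_group hN.mul_left_cancel
      hN.mul_right_cancel ore
    let φ : cs.IntervalGroup w →* Γ := PresentedGroup.toGroup (f := fun x => f (ι x)) (by
      rintro _ ⟨x, y, z, h1, h2, rfl⟩
      simp only [map_mul, map_inv, FreeGroup.lift_apply_of]
      rw [← map_mul, hι.map_mul x y z ⟨h1, h2⟩, mul_inv_cancel])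
    have : ∀ m, φ (F m) = f m := fun m => by
      induction m using hι.induction_left with
      | one => simp only [map_one]
      | mul x m hm =>
        simp only [map_mul, hm, hF]
        rw [PresentedGroup.toGroup.of]
    intro a b hab
    exact hf (by rw [← this, hab, this])
  let ψ : N ≃* MonoidHom.mrange F := MulEquiv.ofBijective (MonoidHom.mrangeRestrict F)
    ⟨fun a b hab => hinj (congrArg Subtype.val hab), MonoidHom.mrangeRestrict_surjective F⟩
  refine ⟨MonoidHom.mrange F, ψ (ι δ), garside (hι.map ψ), fun g => ?_⟩
  let S : Subgroup (cs.IntervalGroup w) :=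
    { carrier := {g | ∃ a b, g = (F a)⁻¹ * F b}
      one_mem' := ⟨1, 1, by simp⟩
      mul_mem' := by
        rintro _ _ ⟨a, b, rfl⟩ ⟨a', b', rfl⟩
        obtain ⟨p, q, hpq⟩ := ore b a'
        refine ⟨p * a, q * b', ?_⟩
        have := congrArg F hpq
        rw [map_mul, map_mul, ← eq_inv_mul_iff_mul_eq] at this
        rw [this, map_mul, map_mul]
        group
      inv_mem' := by
        rintro _ ⟨a, b, rfl⟩
        exact ⟨b, a, by group⟩ }
  have hS : g ∈ S := by
    have : (⊤ : Subgroup (cs.IntervalGroup w)) ≤ S := by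
      rw [← PresentedGroup.closure_range_of, Subgroup.closure_le]
      rintro _ ⟨x, rfl⟩
      exact ⟨1, ι x, by rw [map_one, inv_one, one_mul, hF]⟩
    exact this trivial
  obtain ⟨a, b, rfl⟩ := hS
  exact ⟨ψ a, ψ b, rfl⟩

end CoxeterSystem

/-! ### The Coxeter group of type `H₃` -/

namespace H3Model

open Equiv CoxeterSystem

/-- Three double transpositions of five points that satisfy the Coxeter relations of type `H₃`. -/
def gen : Fin 3 → Perm (Fin 5) :=
  ![swap 1 2 * swap 3 4, swap 0 1 * swap 3 4, swap 1 3 * swap 2 4]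

/-- Reduced words for the elements of the parabolic subgroup generated by the last two simple
reflections, a dihedral group of order `10`. -/
def parabolicWords : List (List (Fin 3)) :=
  [[], [1], [2], [1, 2], [2, 1], [1, 2, 1], [2, 1, 2], [1, 2, 1, 2], [2, 1, 2, 1], [2, 1, 2, 1, 2]]

/-- Reduced words for the minimal right coset representatives of that parabolic subgroup. -/
def cosetWords : List (List (Fin 3)) :=
  [[], [0], [0, 1], [0, 1, 2], [0, 1, 2, 1], [0, 1, 2, 1, 2], [0, 1, 2, 1, 0], [0, 1, 2, 1, 2, 0],
    [0, 1, 2, 1, 2, 0, 1], [0, 1, 2, 1, 2, 0, 1, 2], [0, 1, 2, 1, 2, 0, 1, 2, 1],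
    [0, 1, 2, 1, 2, 0, 1, 2, 1, 0]]

/-- The coset representatives `d` and simple reflections `sᵢ` for which neither `d sᵢ` nor `d` with
its last letter `i` removed is listed among the coset representatives, with `h` and `d'` such that
`d sᵢ = h d'`. -/
def cosetSteps : List (List (Fin 3) × Fin 3 × List (Fin 3) × List (Fin 3)) :=
  [([], 2, [2], []), ([], 1, [1], []), ([0], 2, [2], [0]), ([0, 1], 0, [1], [0, 1]),
    ([0, 1, 2], 0, [1], [0, 1, 2]), ([0, 1, 2, 1, 2], 1, [2], [0, 1, 2, 1, 2]),
    ([0, 1, 2, 1, 0], 1, [1], [0, 1, 2, 1, 0]), ([0, 1, 2, 1, 0], 2, [], [0, 1, 2, 1, 2, 0]),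
    ([0, 1, 2, 1, 2, 0], 2, [], [0, 1, 2, 1, 0]),
    ([0, 1, 2, 1, 2, 0, 1], 0, [2], [0, 1, 2, 1, 2, 0, 1]),
    ([0, 1, 2, 1, 2, 0, 1, 2], 0, [2], [0, 1, 2, 1, 2, 0, 1, 2]),
    ([0, 1, 2, 1, 2, 0, 1, 2, 1], 2, [1], [0, 1, 2, 1, 2, 0, 1, 2, 1]),
    ([0, 1, 2, 1, 2, 0, 1, 2, 1, 0], 2, [1], [0, 1, 2, 1, 2, 0, 1, 2, 1, 0]),
    ([0, 1, 2, 1, 2, 0, 1, 2, 1, 0], 1, [2], [0, 1, 2, 1, 2, 0, 1, 2, 1, 0])]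

theorem coset_step : ∀ d ∈ cosetWords, ∀ i, d ++ [i] ∈ cosetWords ∨
    (∃ d' ∈ cosetWords, d = d' ++ [i]) ∨
    ∃ p ∈ cosetSteps, p.1 = d ∧ p.2.1 = i ∧ p.2.2.1 ∈ [[], [1], [2]] ∧ p.2.2.2 ∈ cosetWords := by
  decide +kernel

theorem isLiftable_gen :
    CoxeterMatrix.H₃.IsLiftable fun i => ((gen i, -1) : Perm (Fin 5) × ℤˣ) := by
  unfold CoxeterMatrix.IsLiftable
  decide +kernel

variable {W : Type*} [Group W] (cs : CoxeterSystem CoxeterMatrix.H₃ W)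

/-- The braid relations, completed to a confluent rewriting system, prove the equations
`d sᵢ = h d'`. -/
theorem wordProd_cosetSteps : ∀ p ∈ cosetSteps,
    cs.wordProd p.1 * cs.simple p.2.1 = cs.wordProd (p.2.2.1 ++ p.2.2.2) := by
  obtain ⟨a, ha⟩ : ∃ a, a = cs.simple 2 := ⟨_, rfl⟩
  obtain ⟨b, hb⟩ : ∃ b, b = cs.simple 1 := ⟨_, rfl⟩
  obtain ⟨c, hc⟩ : ∃ c, c = cs.simple 0 := ⟨_, rfl⟩
  have haa : a * a = 1 := ha ▸ cs.simple_mul_simple_self 2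
  have hca : c * a = a * c := by
    have := cs.wordProd_braidWord_eq 0 2
    simpa [braidWord, alternatingWord, wordProd, ha, hc, CoxeterMatrix.H₃] using this
  have hcbc : c * (b * c) = b * (c * b) := by
    have := cs.wordProd_braidWord_eq 0 1
    simpa [braidWord, alternatingWord, wordProd, hb, hc, CoxeterMatrix.H₃, mul_assoc] using this.symm
  have hbabab : b * (a * (b * (a * b))) = a * (b * (a * (b * a))) := by
    have := cs.wordProd_braidWord_eq 1 2
    simpa [braidWord, alternatingWord, wordProd, hb, ha, CoxeterMatrix.H₃, mul_assoc] using this.symm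
  have cons : ∀ {x y : W} (z : W), x = y → x * z = y * z := fun z h => congrArg (· * z) h
  have haa' : ∀ z, a * (a * z) = z := fun z => by rw [← mul_assoc, haa, one_mul]
  have hca' : ∀ z, c * (a * z) = a * (c * z) := fun z => by
    simpa only [mul_assoc] using cons z hca
  have hcbc' : ∀ z, c * (b * (c * z)) = b * (c * (b * z)) := fun z => by
    simpa only [mul_assoc] using cons z hcbc
  have hbabab' : ∀ z, b * (a * (b * (a * (b * z)))) = a * (b * (a * (b * (a * z)))) := fun z => by
    simpa only [mul_assoc] using cons z hbabab
  have hcbac : c * (b * (a * c)) = b * (c * (b * a)) := by rw [← hca, hcbc']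
  have hcbac' : ∀ z, c * (b * (a * (c * z))) = b * (c * (b * (a * z))) := fun z => by
    simpa only [mul_assoc] using cons z hcbac
  have hcbabcb : c * (b * (a * (b * (c * b)))) = b * (c * (b * (a * (b * c)))) := by
    rw [← hcbc, hcbac']
  have hcbabcb' : ∀ z, c * (b * (a * (b * (c * (b * z))))) = b * (c * (b * (a * (b * (c * z))))) :=
    fun z => by simpa only [mul_assoc] using cons z hcbabcb
  have hlong : c * (b * (a * (b * (a * (c * (b * (a * (b * a)))))))) =
      b * (c * (b * (a * (b * (a * (c * (b * (a * b)))))))) := by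
    rw [← hca', ← hbabab, hcbabcb', hca']
  have hlong' : c * (b * (a * (b * (a * (c * (b * (a * (b * (a * c))))))))) =
      b * (c * (b * (a * (b * (a * (c * (b * (a * (b * c))))))))) := by
    simpa only [mul_assoc] using cons c hlong
  simp only [cosetSteps, List.forall_mem_cons, List.not_mem_nil, false_imp_iff, implies_true,
    List.nil_append, List.cons_append, wordProd_cons, wordProd_nil, ← ha, ← hb, ← hc,
    mul_one, one_mul, mul_assoc, haa', hca, hcbc, hbabab, hca', hbabab', hcbac, hcbabcb, hlong,
    hlong', and_self]

theorem parabolic_step : ∀ h ∈ parabolicWords, ∀ i ∈ [1, 2], h ++ [i] ∈ parabolicWords ∨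
    (∃ h' ∈ parabolicWords, h = h' ++ [i]) ∨ h = [1, 2, 1, 2] ∧ i = 1 ∨
    h = [2, 1, 2, 1, 2] ∧ i = 1 := by
  decide +kernel

theorem exists_parabolicWord {h : List (Fin 3)} (hh : h ∈ parabolicWords) {i : Fin 3}
    (hi : i ∈ [1, 2]) :
    ∃ h' ∈ parabolicWords, cs.wordProd h * cs.simple i = cs.wordProd h' := by
  have hbraid : cs.wordProd [1, 2, 1, 2, 1] = cs.wordProd [2, 1, 2, 1, 2] := by
    simpa [braidWord, alternatingWord, CoxeterMatrix.H₃] using cs.wordProd_braidWord_eq 2 1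
  rcases parabolic_step h hh i hi with hm | ⟨h', hm, rfl⟩ | ⟨rfl, rfl⟩ | ⟨rfl, rfl⟩
  · exact ⟨_, hm, by rw [wordProd_append, wordProd_singleton]⟩
  · exact ⟨_, hm, by rw [wordProd_append, wordProd_singleton, simple_mul_simple_cancel_right]⟩
  · refine ⟨[2, 1, 2, 1, 2], by decide, ?_⟩
    rw [← hbraid, ← wordProd_singleton, ← wordProd_append]
    rfl
  · refine ⟨[1, 2, 1, 2], by decide, ?_⟩
    rw [← hbraid, show [1, 2, 1, 2, 1] = [1, 2, 1, 2] ++ [(1 : Fin 3)] from rfl, wordProd_append,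
      wordProd_singleton, simple_mul_simple_cancel_right]

/-- `W` has at most `120` elements: each is a product of a parabolic element and a coset
representative. -/
theorem exists_normalForm (x : W) :
    ∃ h ∈ parabolicWords, ∃ d ∈ cosetWords, x = cs.wordProd (h ++ d) := by
  induction x using cs.simple_induction_right with
  | one => exact ⟨[], by decide, [], by decide, by simp⟩
  | mul_simple_right x i hx =>
    obtain ⟨h, hh, d, hd, rfl⟩ := hx
    rcases coset_step d hd i with hm | ⟨d', hm, rfl⟩ | ⟨⟨d, i, h', d'⟩, hp, rfl, rfl, hh', hm⟩
    · exact ⟨h, hh, _, hm, by rw [← List.append_assoc, wordProd_append _ _ [i], wordProd_singleton]⟩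
    · exact ⟨h, hh, d', hm, by
        rw [← List.append_assoc, wordProd_append _ _ [i], wordProd_singleton,
          simple_mul_simple_cancel_right]⟩
    · have hstep := wordProd_cosetSteps cs _ hp
      dsimp only at hstep hh' hm ⊢
      rw [wordProd_append, mul_assoc, hstep, wordProd_append, ← mul_assoc]
      obtain ⟨h'', hh'', heq⟩ :
          ∃ h'' ∈ parabolicWords, cs.wordProd h * cs.wordProd h' = cs.wordProd h'' := by
        simp only [List.mem_cons, List.not_mem_nil, or_false] at hh'
        rcases hh' with rfl | rfl | rfl
        · exact ⟨h, hh, by simp⟩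
        · simpa using exists_parabolicWord cs hh (i := 1) (by decide)
        · simpa using exists_parabolicWord cs hh (i := 2) (by decide)
      exact ⟨h'', hh'', d', hm, by rw [heq, wordProd_append]⟩

end H3Model

/-! ### The model `A₅ × {±1}` -/

namespace H3Model

open Equiv CoxeterSystem

/-- The value of a word in the simple reflections under the homomorphism to `A₅ × {±1}` that sends
the simple reflection `i` to `(gen i, -1)`. -/
def evalWord (l : List (Fin 3)) : Perm (Fin 5) × ℤˣ := (l.map fun i => (gen i, -1)).prod

theorem eq_nil_of_evalWord_eq_one : ∀ h ∈ parabolicWords, ∀ d ∈ cosetWords,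
    evalWord (h ++ d) = 1 → h ++ d = [] := by
  decide +kernel

/-- The simple reflections generate all even permutations. -/
theorem exists_evalWord : ∀ σ : Perm (Fin 5), Perm.sign σ = 1 →
    ∃ h ∈ parabolicWords, ∃ d ∈ cosetWords, (evalWord (h ++ d)).1 = σ := by
  decide +kernel

/-- The fifth power of a Coxeter element is the central involution of `W`. -/
theorem evalWord_coxeter_pow :
    evalWord [0, 1, 2, 0, 1, 2, 0, 1, 2, 0, 1, 2, 0, 1, 2] = (1, -1) := by
  decide +kernel

theorem evalWord_coxeter_pow_ten :
    ∀ i j k, [i, j, k].Nodup → evalWord [i, j, k] ^ 10 = 1 := by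
  decide +kernel

theorem sign_gen : ∀ i, Perm.sign (gen i) = 1 := by
  decide +kernel

theorem gen_ne_one : ∀ i, gen i ≠ 1 := by
  decide +kernel

theorem gen_mul_self : ∀ i, gen i * gen i = 1 := by
  decide +kernel

/-- The involutions of `A₅` form one conjugacy class. -/
theorem exists_conj_gen : ∀ σ : Perm (Fin 5), Perm.sign σ = 1 → σ * σ = 1 → σ ≠ 1 →
    ∃ τ : Perm (Fin 5), Perm.sign τ = 1 ∧ τ * gen 0 * τ⁻¹ = σ := by
  decide +kernel

/-- Every non-trivial even permutation of five points is a product of two involutions. -/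
theorem exists_mul_involution : ∀ σ : Perm (Fin 5), Perm.sign σ = 1 → σ ≠ 1 →
    ∃ τ : Perm (Fin 5), (Perm.sign τ = 1 ∧ τ * τ = 1 ∧ τ ≠ 1) ∧
      τ * σ * (τ * σ) = 1 ∧ τ * σ ≠ 1 := by
  decide +kernel

/-- A three-cycle. -/
def cyc : Perm (Fin 5) := swap 0 1 * swap 1 2

/-- The only elements of `A₅` whose order divides `6` but not `2` are the three-cycles, which form
one conjugacy class. -/
theorem exists_conj_cyc : ∀ σ : Perm (Fin 5), Perm.sign σ = 1 → σ ^ 6 = 1 → σ ^ 2 ≠ 1 →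
    σ ^ 3 = 1 ∧ ∃ τ : Perm (Fin 5), Perm.sign τ = 1 ∧ τ * cyc * τ⁻¹ = σ := by
  decide +kernel

/-- The reflection length in terms of the model. The sign is the determinant, so the elements of
sign `1` have even and those of sign `-1` odd length. -/
def len (p : Perm (Fin 5) × ℤˣ) : ℕ :=
  if p.2 = 1 then if p.1 = 1 then 0 else 2 else if p.1 * p.1 = 1 ∧ p.1 ≠ 1 then 1 else 3

/-- A model of `W` adapted to `w`: an isomorphism of `W` onto `A₅ × {±1}` such that reflections
correspond to the pairs of an involution and `-1`, and `w` to the pair of `cyc` and `-1`. -/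
structure IsModel {W : Type*} [Group W] (cs : CoxeterSystem CoxeterMatrix.H₃ W) (w : W)
    (f : W →* Perm (Fin 5) × ℤˣ) : Prop where
  injective : Function.Injective f
  sign_eq : ∀ x, Perm.sign (f x).1 = 1
  surjective : ∀ σ e, Perm.sign σ = 1 → ∃ x, f x = (σ, e)
  isReflection_iff : ∀ x, cs.IsReflection x ↔ (f x).2 = -1 ∧ (f x).1 * (f x).1 = 1 ∧ (f x).1 ≠ 1
  map_eq : f w = (cyc, -1)

variable {W : Type*} [Group W] (cs : CoxeterSystem CoxeterMatrix.H₃ W)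

/-- The words of the normal form have different values, so `W` is isomorphic to `A₅ × {±1}`; the
element that corresponds to `(cyc, -1)` has order `6`, whereas Coxeter elements have order `10`. -/
theorem exists_isModel : ∃ w f, IsModel cs w f ∧ ¬ cs.IsCoxeterElement w := by
  let f := cs.lift ⟨_, isLiftable_gen⟩
  have hf : ∀ i, f (cs.simple i) = (gen i, -1) := fun i => cs.lift_apply_simple isLiftable_gen i
  have hword : ∀ l, f (cs.wordProd l) = evalWord l := fun l => by
    rw [wordProd, map_list_prod, List.map_map]
    exact congrArg List.prod (List.map_congr_left fun i _ => hf i)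
  have inj : Function.Injective f := by
    rw [injective_iff_map_eq_one]
    intro x hx
    obtain ⟨h, hh, d, hd, rfl⟩ := exists_normalForm cs x
    rw [hword] at hx
    rw [eq_nil_of_evalWord_eq_one h hh d hd hx, wordProd_nil]
  have sgn : ∀ x, Perm.sign (f x).1 = 1 := fun x => by
    induction x using cs.simple_induction with
    | simple i => rw [hf]; exact sign_gen i
    | one => rw [map_one]; rfl
    | mul x y hx hy => rw [map_mul, Prod.fst_mul, map_mul, hx, hy, one_mul]
  have surj : ∀ σ e, Perm.sign σ = 1 → ∃ x, f x = (σ, e) := fun σ e hσ => by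
    obtain ⟨h, -, d, -, rfl⟩ := exists_evalWord σ hσ
    by_cases he : (evalWord (h ++ d)).2 = e
    · exact ⟨cs.wordProd (h ++ d), by rw [hword, ← he]⟩
    · refine ⟨cs.wordProd (h ++ d) * cs.wordProd [0, 1, 2, 0, 1, 2, 0, 1, 2, 0, 1, 2, 0, 1, 2], ?_⟩
      rw [map_mul, hword, hword, evalWord_coxeter_pow]
      refine Prod.ext (mul_one _) ?_
      change _ * (-1) = e
      rw [mul_neg_one, Int.units_ne_iff_eq_neg.1 he, neg_neg]
  have hcyc : Perm.sign cyc = 1 := by decide +kernel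
  obtain ⟨w, hw⟩ := surj cyc (-1) hcyc
  refine ⟨w, f, ⟨inj, sgn, surj, fun x => ⟨?_, ?_⟩, hw⟩, ?_⟩
  · rintro ⟨g, i, rfl⟩
    simp only [map_mul, map_inv, hf, Prod.fst_mul, Prod.snd_mul, Prod.fst_inv, Prod.snd_inv]
    refine ⟨by rw [mul_comm, inv_mul_cancel_left], ?_, fun h => gen_ne_one i (conj_eq_one_iff.1 h)⟩
    rw [conj_mul, gen_mul_self, mul_one, mul_inv_cancel]
  · rintro ⟨h1, h2, h3⟩
    obtain ⟨τ, hτ, hc⟩ := exists_conj_gen _ (sgn x) h2 h3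
    obtain ⟨g, hg⟩ := surj τ 1 hτ
    refine ⟨g, 0, inj ?_⟩
    rw [map_mul, map_mul, map_inv, hg, hf]
    exact Prod.ext hc.symm (by rw [h1]; rfl)
  -- The order of a Coxeter element is `10`.
  · rintro ⟨l, h1, h2, h3⟩
    obtain ⟨g, hg⟩ := isConj_iff.1 h3
    have hl : l.Perm [0, 1, 2] := (List.perm_ext_iff_of_nodup h1 (by decide)).2 fun i =>
      ⟨fun _ => by fin_cases i <;> decide, fun _ => h2 i⟩
    obtain ⟨i, j, k, rfl⟩ := List.length_eq_three.1 hl.length_eq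
    have h10 : (cyc, (-1 : ℤˣ)) ^ 10 = 1 := by
      rw [← hw, ← hg, map_mul, map_mul, map_inv, conj_pow, hword, evalWord_coxeter_pow_ten i j k h1,
        mul_one, mul_inv_cancel]
    exact absurd h10 (by decide +kernel)

namespace IsModel

variable {cs} {w : W} {f : W →* Perm (Fin 5) × ℤˣ}

/-- A model adapted to `w` is conjugated into one adapted to a conjugate of `w`. -/
theorem conj (h : IsModel cs w f) (g : W) :
    IsModel cs (g * w * g⁻¹) (f.comp (MulAut.conj g⁻¹).toMonoidHom) where
  injective := h.injective.comp (MulAut.conj g⁻¹).injective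
  sign_eq x := h.sign_eq _
  surjective σ e hσ := by
    obtain ⟨x, hx⟩ := h.surjective σ e hσ
    exact ⟨MulAut.conj g x, by simp [← hx, mul_assoc]⟩
  isReflection_iff x := by
    rw [← isReflection_conj_iff cs g⁻¹]
    exact h.isReflection_iff _
  map_eq := by simp [← h.map_eq, mul_assoc]

/-- Every rotation is a product of two reflections, and the determinant gives the parity. -/
theorem reflLength_eq (h : IsModel cs w f) (x : W) : cs.reflLength x = len (f x) := by
  have one_of : ∀ t, cs.IsReflection t → cs.reflLength t ≤ 1 := fun t ht =>
    Nat.sInf_le ⟨[t], ⟨by simpa using ht, by simp⟩, rfl⟩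
  have le_of_mul : ∀ t y, cs.IsReflection t → cs.reflLength (t * y) ≤ 1 + cs.reflLength y :=
    fun t y ht => (cs.reflLength_mul_le t y).trans (Nat.add_le_add_right (one_of t ht) _)
  have even_le : ∀ y, (f y).2 = 1 → cs.reflLength y ≤ 2 := fun y hy => by
    by_cases hy1 : (f y).1 = 1
    · rw [h.injective (show f y = f 1 by rw [map_one]; exact Prod.ext hy1 hy), cs.reflLength_one]
      omega
    · obtain ⟨τ, ⟨h1, h2, h3⟩, h4, h5⟩ := exists_mul_involution _ (h.sign_eq y) hy1
      obtain ⟨t, ht⟩ := h.surjective τ (-1) h1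
      have htr : cs.IsReflection t := (h.isReflection_iff t).2 (by rw [ht]; exact ⟨rfl, h2, h3⟩)
      have hty : cs.IsReflection (t * y) := (h.isReflection_iff _).2 (by
        rw [map_mul, ht]
        exact ⟨by rw [Prod.snd_mul, hy, mul_one], h4, h5⟩)
      have := le_of_mul t (t * y) htr
      have hinv : t * (t * y) = y := by rw [← mul_assoc, htr.mul_self, one_mul]
      rw [hinv] at this
      have := one_of _ hty
      omega
  -- A product of `k` reflections has determinant `(-1) ^ k`.
  obtain ⟨l, hl, hk⟩ := cs.exists_reduced_reflFactorization x
  have parity : ∀ l : List W, (∀ t ∈ l, cs.IsReflection t) → (f l.prod).2 = (-1) ^ l.length := by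
    intro l
    induction l with
    | nil => intro _; rw [List.prod_nil, map_one]; rfl
    | cons t l ih =>
      intro hl
      rw [List.forall_mem_cons] at hl
      rw [List.prod_cons, map_mul, Prod.snd_mul, ih hl.2, ((h.isReflection_iff t).1 hl.1).1,
        List.length_cons, pow_succ']
  have hpar := parity l hl.1
  rw [hl.2, hk] at hpar
  have one_iff : cs.reflLength x = 1 → cs.IsReflection x := fun h1 => by
    rw [h1, List.length_eq_one_iff] at hk
    obtain ⟨t, rfl⟩ := hk
    rw [← hl.2, List.prod_singleton]
    exact hl.1 t (List.mem_singleton_self t)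
  unfold len
  split_ifs with h1 h2 h3
  · rw [h.injective (show f x = f 1 by rw [map_one]; exact Prod.ext h2 h1), cs.reflLength_one]
  · have hle := even_le x h1
    rw [h1] at hpar
    have h0 : cs.reflLength x ≠ 0 := fun h0 =>
      h2 (by rw [cs.eq_one_of_reflLength_eq_zero h0, map_one]; rfl)
    have hne : cs.reflLength x ≠ 1 := fun h0 => by rw [h0] at hpar; revert hpar; decide
    omega
  · have hx : cs.IsReflection x := (h.isReflection_iff x).2
      ⟨(Int.units_eq_one_or _).resolve_left h1, h3.1, h3.2⟩
    have h0 : cs.reflLength x ≠ 0 := fun h0 =>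
      h3.2 (by rw [cs.eq_one_of_reflLength_eq_zero h0, map_one]; rfl)
    have := one_of x hx
    omega
  · have hx : (f x).2 = -1 := (Int.units_eq_one_or _).resolve_left h1
    have hs := cs.isReflection_simple 0
    have hle := le_of_mul _ (cs.simple 0 * x) hs
    rw [simple_mul_simple_cancel_left] at hle
    have := even_le (cs.simple 0 * x) (by
      rw [map_mul, Prod.snd_mul, ((h.isReflection_iff _).1 hs).1, hx]; rfl)
    have h0 : cs.reflLength x ≠ 0 := fun h0 => by rw [h0] at hpar; exact h1 hpar
    have hne : cs.reflLength x ≠ 1 := fun h1 =>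
      h3 ((h.isReflection_iff x).1 (one_iff h1)).2
    have hne2 : cs.reflLength x ≠ 2 := fun h0 => by rw [h0] at hpar; exact h1 (by rw [hpar]; rfl)
    omega

end IsModel

end H3Model

/-! ### The conjugacy class and the lattice property -/

/-- A bounded poset with a rank function with values at most `3`, in which two different elements of
rank `1` have at most one common upper bound of rank `2`, has binary joins. -/
theorem exists_isLUB_of_rank {α : Type*} [PartialOrder α] (r : α → ℕ) (hr : StrictMono r)
    (bot top : α) (hbot : ∀ x, bot ≤ x) (htop : ∀ x, x ≤ top) (htop3 : r top ≤ 3)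
    (key : ∀ x y z z', r x = 1 → r y = 1 → r z = 2 → r z' = 2 → x ≠ y → x ≤ z → y ≤ z →
      x ≤ z' → y ≤ z' → z = z') (x y : α) : ∃ z, IsLUB {x, y} z := by
  have lub_iff : ∀ z, IsLUB {x, y} z ↔ x ≤ z ∧ y ≤ z ∧ ∀ z', x ≤ z' → y ≤ z' → z ≤ z' := by
    intro z
    simp only [IsLUB, IsLeast, upperBounds_insert, upperBounds_singleton, mem_lowerBounds,
      Set.mem_inter_iff, Set.mem_Ici, and_assoc, and_imp]
  simp only [lub_iff]
  by_cases hxy : x ≤ y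
  · exact ⟨y, hxy, le_rfl, fun z' _ h => h⟩
  by_cases hyx : y ≤ x
  · exact ⟨x, le_rfl, hyx, fun z' h _ => h⟩
  have lt_of_ub : ∀ z, x ≤ z → y ≤ z → r x < r z ∧ r y < r z := fun z hx hy =>
    ⟨hr (hx.lt_of_ne fun h => hyx (h ▸ hy)), hr (hy.lt_of_ne fun h => hxy (h ▸ hx))⟩
  have hx0 := hr ((hbot x).lt_of_ne fun h => hxy (h ▸ hbot y))
  have hy0 := hr ((hbot y).lt_of_ne fun h => hyx (h ▸ hbot x))
  have ub : ∀ z, x ≤ z → y ≤ z → z ≠ top → r z = 2 ∧ r x = 1 ∧ r y = 1 := fun z hx hy hz => by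
    have h1 := lt_of_ub z hx hy
    have h2 := hr ((htop z).lt_of_ne hz)
    omega
  by_cases hz : ∃ z, x ≤ z ∧ y ≤ z ∧ z ≠ top
  · obtain ⟨z, hxz, hyz, hz⟩ := hz
    refine ⟨z, hxz, hyz, fun z' hx hy => ?_⟩
    by_cases hz' : z' = top
    · exact hz' ▸ htop z
    · obtain ⟨h1, h2, h3⟩ := ub z hxz hyz hz
      exact (key x y z z' h2 h3 h1 (ub z' hx hy hz').1 (fun h => hxy h.le) hxz hyz hx hy).le
  · push Not at hz
    exact ⟨top, htop x, htop y, fun z' hx hy => (hz z' hx hy).ge⟩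

namespace CoxeterSystem

variable {B W : Type*} [Group W] {M : CoxeterMatrix B} {cs : CoxeterSystem M W}

theorem IsCoxeterElement.of_isConj {w w' : W} (h : cs.IsCoxeterElement w) (hw : IsConj w w') :
    cs.IsCoxeterElement w' := by
  obtain ⟨l, h1, h2, h3⟩ := h
  exact ⟨l, h1, h2, h3.trans hw⟩

theorem reflLength_conj (g x : W) : cs.reflLength (g * x * g⁻¹) = cs.reflLength x :=
  cs.isConjLength_reflLength.conj g x

theorem IsQuasiCoxeter.conj {w : W} (h : cs.IsQuasiCoxeter w) (g : W) :
    cs.IsQuasiCoxeter (g * w * g⁻¹) := by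
  obtain ⟨l, hl, hk, hc⟩ := h
  refine ⟨l.map (MulAut.conj g), ⟨?_, ?_⟩, ?_, ?_⟩
  · intro r hr
    obtain ⟨t, ht, rfl⟩ := List.mem_map.1 hr
    exact (hl.1 t ht).conj g
  · rw [← map_list_prod, hl.2, MulAut.conj_apply]
  · rw [List.length_map, hk, reflLength_conj]
  · have : {t | t ∈ l.map (MulAut.conj g)} = (MulAut.conj g).toMonoidHom '' {t | t ∈ l} := by
      ext t
      simp
    rw [this, ← MonoidHom.map_closure, hc, Subgroup.map_top_of_surjective _
      (MulAut.conj g).surjective]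

end CoxeterSystem

namespace H3Model

open Equiv CoxeterSystem

/-- The involutions in `A₅`, listed as the orbits of five of them under conjugation by `cyc`. -/
def inv (i : Fin 5 × Fin 3) : Perm (Fin 5) :=
  (cyc ^ i.2.val)⁻¹ * ![swap 1 3 * swap 2 4, swap 0 3 * swap 2 4, swap 0 2 * swap 1 3,
    swap 1 2 * swap 3 4, swap 0 1 * swap 2 4] i.1 * cyc ^ i.2.val

theorem involution_iff : ∀ σ : Perm (Fin 5),
    (Perm.sign σ = 1 ∧ σ * σ = 1 ∧ σ ≠ 1) ↔ ∃ i, inv i = σ := by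
  decide +kernel

theorem inv_injective : ∀ i j, inv i = inv j → i = j := by
  decide +kernel

/-- The axes of the products of two reflections below `w` are pairwise different. -/
theorem eq_of_common_divisors : ∀ p i, (inv i * (cyc * inv p)) * (inv i * (cyc * inv p)) = 1 →
    ∀ q, p ≠ q → (inv i * (cyc * inv q)) * (inv i * (cyc * inv q)) = 1 →
    ∀ j, (inv j * (cyc * inv p)) * (inv j * (cyc * inv p)) = 1 →
    (inv j * (cyc * inv q)) * (inv j * (cyc * inv q)) = 1 → i = j := by
  decide +kernel

end H3Model

/-! ### Two presentations of the dual braid relations -/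

namespace H3Model

open Equiv CoxeterSystem

/-- The index of the conjugate of the `i`-th reflection by the inverse of `w`. -/
def shift (i : Fin 5 × Fin 3) : Fin 5 × Fin 3 := (i.1, i.2 + 1)

/-- A family of group elements that satisfies the relations between the reflections below `w`:
conjugation by the element `D` in the place of `w` permutes the family as it permutes the
reflections, and reduced factorizations of `w` become factorizations of `D`. -/
structure IsDualSystem {X : Type*} [Group X] (T : Fin 5 × Fin 3 → X) (D : X) : Prop where
  conj : ∀ i, D⁻¹ * T i * D = T (shift i)
  triple : ∀ i j k, inv i * inv j * inv k = cyc → T i * T j * T k = D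

/-- The braid relations of the triangle and the two additional relations of the presentation. -/
structure TriangleRelations {X : Type*} [Group X] (t u v : X) : Prop where
  braid_tu : t * u * t = u * t * u
  braid_tv : t * v * t = v * t * v
  braid_uv : u * v * u * v * u = v * u * v * u * v
  conj_u : u * v * u * t * v * u = v * u * t * v * u * v
  cube : (v * u * t) ^ 3 = (t * v * u) ^ 3

/-- Representatives of the orbits of the reflections under conjugation by `w`, written in three of
them whose product `v u t` takes the place of `w`. -/
def base {X : Type*} [Group X] (t u v : X) : Fin 5 → X :=
  ![t, u, v, v * u * t * (((v * u * t) ^ 2)⁻¹ * t * (v * u * t) ^ 2)⁻¹ * u⁻¹, t⁻¹ * u * t]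

/-- The reflections below `w`, written in three of them. -/
def dual {X : Type*} [Group X] (t u v : X) (i : Fin 5 × Fin 3) : X :=
  ((v * u * t) ^ i.2.val)⁻¹ * base t u v i.1 * (v * u * t) ^ i.2.val

/-- The Hurwitz move that takes the last factor of a factorization of `w` to the front, where it is
conjugated by `w`. -/
def rotate (p : (Fin 5 × Fin 3) × (Fin 5 × Fin 3) × (Fin 5 × Fin 3)) :
    (Fin 5 × Fin 3) × (Fin 5 × Fin 3) × (Fin 5 × Fin 3) :=
  ((p.2.2.1, p.2.2.2 - 1), p.1, p.2.1)

/-- Representatives of the reduced factorizations of `w` up to rotation. -/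
def factorizations : List ((Fin 5 × Fin 3) × (Fin 5 × Fin 3) × (Fin 5 × Fin 3)) :=
  [((2, 0), (1, 0), (0, 0)), ((0, 0), (4, 0), (2, 1)), ((4, 0), (0, 1), (1, 0)),
    ((4, 0), (1, 0), (2, 1)), ((3, 0), (1, 0), (0, 2)), ((3, 0), (0, 2), (1, 0))]

/-- The reduced factorizations of `w` form six orbits of length nine under rotation. -/
theorem exists_rotate : ∀ i j k, inv i * inv j * inv k = cyc →
    ∃ p ∈ factorizations, ∃ n : Fin 9, rotate^[n] p = (i, j, k) := by
  decide +kernel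

variable {X : Type*} [Group X]

namespace TriangleRelations

variable {t u v : X}

theorem commute_t (h : TriangleRelations t u v) : Commute ((v * u * t) ^ 3) t := by
  have : t * (v * u * t) ^ 3 = (t * v * u) ^ 3 * t := by simp only [pow_succ, pow_zero]; group
  rw [Commute, SemiconjBy, this, h.cube]

theorem commute_u (h : TriangleRelations t u v) : Commute ((v * u * t) ^ 3) u := by
  refine Eq.symm ?_
  calc u * (v * u * t) ^ 3 = u * v * u * t * v * u * t * v * u * t := by
        simp only [pow_succ, pow_zero, one_mul, mul_assoc]
    _ = v * u * t * v * u * (v * t * v) * u * t := by rw [h.conj_u]; simp only [mul_assoc]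
    _ = (v * u * t) * (v * u * t) * v * (t * u * t) := by
        rw [← h.braid_tv]; simp only [mul_assoc]
    _ = (v * u * t) ^ 3 * u := by
        rw [h.braid_tu]; simp only [pow_succ, pow_zero, one_mul, mul_assoc]

theorem commute_v (h : TriangleRelations t u v) : Commute ((v * u * t) ^ 3) v := by
  have hv : v = v * u * t * t⁻¹ * u⁻¹ := by group
  rw [congrArg (Commute _) hv]
  exact (((Commute.refl _).pow_left 3).mul_right h.commute_t.inv_right).mul_right
    h.commute_u.inv_right

theorem commute_base (h : TriangleRelations t u v) (o : Fin 5) :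
    Commute ((v * u * t) ^ 3) (base t u v o) := by
  have hD : Commute ((v * u * t) ^ 3) (v * u * t) := (Commute.refl _).pow_left 3
  have hD2 := hD.pow_right 2
  fin_cases o
  · exact h.commute_t
  · exact h.commute_u
  · exact h.commute_v
  · exact (hD.mul_right ((hD2.inv_right.mul_right h.commute_t).mul_right hD2).inv_right).mul_right
      h.commute_u.inv_right
  · exact (h.commute_t.inv_right.mul_right h.commute_u).mul_right h.commute_t

/-- Three solutions of the triangle relations extend to a dual system. As `(v u t) ^ 3` is central,
conjugation by `v u t` has order `3`, and the Hurwitz move `rotate` preserves factorizations. -/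
theorem isDualSystem (h : TriangleRelations t u v) :
    IsDualSystem (dual t u v) (v * u * t) := by
  obtain ⟨D, hD⟩ : ∃ D, D = v * u * t := ⟨_, rfl⟩
  have conj : ∀ i, D⁻¹ * dual t u v i * D = dual t u v (shift i) := by
    rintro ⟨o, k⟩
    simp only [shift, dual, ← hD]
    fin_cases k
    · change D⁻¹ * ((D ^ 0)⁻¹ * base t u v o * D ^ 0) * D = (D ^ 1)⁻¹ * base t u v o * D ^ 1
      group
    · change D⁻¹ * ((D ^ 1)⁻¹ * base t u v o * D ^ 1) * D = (D ^ 2)⁻¹ * base t u v o * D ^ 2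
      group
    · change D⁻¹ * ((D ^ 2)⁻¹ * base t u v o * D ^ 2) * D = (D ^ 0)⁻¹ * base t u v o * D ^ 0
      have hc := h.commute_base o
      rw [← hD] at hc
      rw [pow_zero, inv_one, one_mul, mul_one]
      refine Eq.trans ?_ hc.inv_mul_cancel
      group
  refine hD ▸ ⟨conj, fun i j k hijk => ?_⟩
  -- The property is invariant under rotation, so it suffices to check six factorizations.
  obtain ⟨p, hp, n, hn⟩ := exists_rotate i j k hijk
  let good : (Fin 5 × Fin 3) × (Fin 5 × Fin 3) × (Fin 5 × Fin 3) → Prop := fun p =>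
    dual t u v p.1 * dual t u v p.2.1 * dual t u v p.2.2 = D
  have good_rotate : ∀ p, good p → good (rotate p) := by
    rintro ⟨i, j, k⟩ hg
    have hk := conj (k.1, k.2 - 1)
    rw [shift, sub_add_cancel] at hk
    have hg : dual t u v i * dual t u v j * dual t u v k = D := hg
    change dual t u v (k.1, k.2 - 1) * dual t u v i * dual t u v j = D
    rw [← eq_mul_inv_iff_mul_eq] at hg
    rw [mul_assoc, hg, ← hk]
    group
  have good_iterate : ∀ (n : ℕ) p, good p → good (rotate^[n] p) := fun n => by
    induction n with
    | zero => exact fun p hp => hp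
    | succ n ih => exact fun p hp => ih _ (good_rotate p hp)
  suffices hgood : ∀ p ∈ factorizations, good p by
    have := good_iterate n p (hgood p hp)
    rwa [hn] at this
  have ht : dual t u v (0, 0) = t := by simp [dual, base]
  have hu : dual t u v (1, 0) = u := by simp [dual, base]
  have hv : dual t u v (2, 0) = v := by simp [dual, base]
  have hx : dual t u v (3, 0) = D * ((D ^ 2)⁻¹ * t * D ^ 2)⁻¹ * u⁻¹ := by simp [dual, base, hD]
  have hy : dual t u v (4, 0) = t⁻¹ * u * t := by simp [dual, base]
  have hv1 : dual t u v (2, 1) = D⁻¹ * v * D := by simp [dual, base, hD]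
  have ht1 : dual t u v (0, 1) = D⁻¹ * t * D := by simp [dual, base, hD]
  have ht2 : dual t u v (0, 2) = (D ^ 2)⁻¹ * t * D ^ 2 := by simp [dual, base, hD]
  have htu := h.braid_tu
  -- The third reflection of the orbit of `t` commutes with `u`.
  have hcomm : (D ^ 2)⁻¹ * t * D ^ 2 * u = u * ((D ^ 2)⁻¹ * t * D ^ 2) := by
    have h1 : D⁻¹ * u * D = v * u * v * u⁻¹ * v⁻¹ := by
      have := h.conj_u
      rw [mul_assoc, eq_mul_inv_iff_mul_eq, eq_mul_inv_iff_mul_eq, mul_assoc, mul_assoc,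
        inv_mul_eq_iff_eq_mul, hD]
      simpa only [mul_assoc] using this
    have h2 : t * (D⁻¹ * u * D) * t⁻¹ = D⁻¹ * u * D := by
      rw [h1]
      have e1 : t * (v * u * v * u⁻¹ * v⁻¹) * t⁻¹ = u⁻¹ * v⁻¹ * u * v * u := by
        rw [← h1, hD]; group
      rw [e1, eq_mul_inv_iff_mul_eq, eq_mul_inv_iff_mul_eq]
      have := h.braid_uv
      simp only [mul_assoc] at this ⊢
      rw [inv_mul_eq_iff_eq_mul, inv_mul_eq_iff_eq_mul, this]
    rw [mul_inv_eq_iff_eq_mul] at h2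
    have h3 : u = (D ^ 2)⁻¹ * (D⁻¹ * u * D) * D ^ 2 := by
      have hc := h.commute_u
      rw [← hD] at hc
      refine hc.inv_mul_cancel.symm.trans ?_
      group
    calc (D ^ 2)⁻¹ * t * D ^ 2 * u
        = (D ^ 2)⁻¹ * t * D ^ 2 * ((D ^ 2)⁻¹ * (D⁻¹ * u * D) * D ^ 2) := by rw [← h3]
      _ = (D ^ 2)⁻¹ * (t * (D⁻¹ * u * D)) * D ^ 2 := by group
      _ = (D ^ 2)⁻¹ * (D⁻¹ * u * D) * D ^ 2 * ((D ^ 2)⁻¹ * t * D ^ 2) := by rw [h2]; group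
      _ = u * ((D ^ 2)⁻¹ * t * D ^ 2) := by rw [← h3]
  simp only [factorizations, List.forall_mem_cons, List.not_mem_nil, false_imp_iff, implies_true,
    and_true, good, ht, hu, hv, hx, hy, hv1, ht1, ht2]
  refine ⟨hD.symm, ?_, ?_, ?_, by group, ?_⟩
  · rw [hD]; group
  · calc t⁻¹ * u * t * (D⁻¹ * t * D) * u = t⁻¹ * v⁻¹ * t * v * (u * t * u) := by rw [hD]; group
      _ = t⁻¹ * v⁻¹ * (t * v * t) * u * t := by rw [← htu]; group
      _ = D := by rw [h.braid_tv, hD]; group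
  · calc t⁻¹ * u * t * u * (D⁻¹ * v * D) = t⁻¹ * (u * t * u) * t⁻¹ * u⁻¹ * D := by rw [hD]; group
      _ = D := by rw [← htu]; group
  · rw [mul_assoc, hcomm]; group

end TriangleRelations

namespace IsDualSystem

variable {T : Fin 5 × Fin 3 → X} {D : X}

theorem pow_conj (h : IsDualSystem T D) (o : Fin 5) :
    T (o, 1) = D⁻¹ * T (o, 0) * D ∧ T (o, 2) = (D ^ 2)⁻¹ * T (o, 0) * D ^ 2 ∧
      D⁻¹ * T (o, 2) * D = T (o, 0) := by
  have h0 : D⁻¹ * T (o, 0) * D = T (o, 1) := h.conj (o, 0)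
  have h1 : D⁻¹ * T (o, 1) * D = T (o, 2) := h.conj (o, 1)
  exact ⟨h0.symm, by rw [← h1, ← h0]; simp only [pow_two, mul_inv_rev, mul_assoc], h.conj (o, 2)⟩

theorem mul_eq (h : IsDualSystem T D) : T (2, 0) * T (1, 0) * T (0, 0) = D :=
  h.triple _ _ _ (by decide +kernel)

/-- A dual system is determined by three of its members. -/
theorem eq_dual (h : IsDualSystem T D) : T = dual (T (0, 0)) (T (1, 0)) (T (2, 0)) := by
  have hbase : ∀ o, T (o, 0) = base (T (0, 0)) (T (1, 0)) (T (2, 0)) o := by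
    intro o
    fin_cases o
    · rfl
    · rfl
    · rfl
    · have h1 : T (3, 0) * T (1, 0) * T (0, 2) = D := h.triple _ _ _ (by decide +kernel)
      have h2 : T (3, 0) * T (0, 2) * T (1, 0) = D := h.triple _ _ _ (by decide +kernel)
      rw [(h.pow_conj 0).2.1] at h2
      change T (3, 0) = _ * _ * _ * (_ * _ * _)⁻¹ * _
      rw [h.mul_eq, eq_mul_inv_iff_mul_eq, eq_mul_inv_iff_mul_eq]
      rw [(h.pow_conj 0).2.1] at h1
      exact h1
    · have h1 : T (1, 0) * T (0, 0) * T (2, 1) = D := h.triple _ _ _ (by decide +kernel)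
      have h2 : T (0, 0) * T (4, 0) * T (2, 1) = D := h.triple _ _ _ (by decide +kernel)
      rw [← h1, mul_left_inj] at h2
      change T (4, 0) = _ * _ * _
      rw [mul_assoc, ← h2, inv_mul_cancel_left]
  funext ⟨o, k⟩
  rw [dual, h.mul_eq, ← hbase]
  obtain ⟨h1, h2, -⟩ := h.pow_conj o
  fin_cases k
  · simp
  · simpa using h1
  · exact h2

/-- The braid relations come from the equal products of two reflections below `w`, and the last one
holds because conjugation by `w` has order `3` on the reflections. -/
theorem triangleRelations (h : IsDualSystem T D) :
    TriangleRelations (T (0, 0)) (T (1, 0)) (T (2, 0)) := by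
  have cell : ∀ {i j i' j'} k, inv i * inv j * inv k = cyc → inv i' * inv j' * inv k = cyc →
      T i * T j = T i' * T j' := fun k h1 h2 =>
    mul_right_cancel ((h.triple _ _ k h1).trans (h.triple _ _ k h2).symm)
  -- `y` and the conjugate `u₂` of `u` complete `t, u` and `t, v` to the reflections below an
  -- element of order three.
  have a1 : T (1, 0) * T (0, 0) = T (0, 0) * T (4, 0) :=
    cell (2, 1) (by decide +kernel) (by decide +kernel)
  have a2 : T (1, 0) * T (0, 0) = T (4, 0) * T (1, 0) :=
    cell (2, 1) (by decide +kernel) (by decide +kernel)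
  have b1 : T (2, 0) * T (0, 0) = T (0, 0) * T (1, 2) :=
    cell (4, 0) (by decide +kernel) (by decide +kernel)
  have b2 : T (2, 0) * T (0, 0) = T (1, 2) * T (2, 0) :=
    cell (4, 0) (by decide +kernel) (by decide +kernel)
  -- `u₁, y₂, v, u, x₁` are the reflections below an element of order five.
  have c1 : T (2, 0) * T (1, 0) = T (1, 1) * T (4, 2) :=
    cell (0, 0) (by decide +kernel) (by decide +kernel)
  have c2 : T (2, 0) * T (1, 0) = T (4, 2) * T (2, 0) :=
    cell (0, 0) (by decide +kernel) (by decide +kernel)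
  have c3 : T (2, 0) * T (1, 0) = T (1, 0) * T (3, 1) :=
    cell (0, 0) (by decide +kernel) (by decide +kernel)
  have c4 : T (2, 0) * T (1, 0) = T (3, 1) * T (1, 1) :=
    cell (0, 0) (by decide +kernel) (by decide +kernel)
  have hu := (h.pow_conj 1).1
  have ht := h.pow_conj 0
  have hD := h.mul_eq
  generalize T (0, 0) = t at *
  generalize T (1, 0) = u at *
  generalize T (2, 0) = v at *
  generalize T (1, 1) = u₁ at *
  have e1 : u * (v * u) = v * u * u₁ := by
    nth_rw 1 [c4]
    rw [← mul_assoc, ← c3]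
  have e2 : u₁ * (v * u) = v * u * v := by
    nth_rw 1 [c2]
    rw [← mul_assoc, ← c1]
  refine ⟨?_, ?_, ?_, ?_, ?_⟩
  · rw [mul_assoc, a2, ← mul_assoc, ← a1, a2]
  · rw [mul_assoc, b2, ← mul_assoc, ← b1, b2]
  · calc u * v * u * v * u = u * (v * u) * (v * u) := by simp only [mul_assoc]
      _ = v * u * (u₁ * (v * u)) := by rw [e1, mul_assoc]
      _ = v * u * v * u * v := by rw [e2]; simp only [mul_assoc]
  · have e3 : u * D = D * u₁ := by rw [hu]; group
    calc u * v * u * t * v * u = u * D * (v * u) := by rw [← hD]; simp only [mul_assoc]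
      _ = D * (u₁ * (v * u)) := by rw [e3, mul_assoc]
      _ = v * u * t * v * u * v := by rw [e2, ← hD]; simp only [mul_assoc]
  · have hc : t * D ^ 3 = D ^ 3 * t := by
      nth_rw 2 [← ht.2.2]
      rw [ht.2.1]
      group
    have : t * (v * u * t) ^ 3 = (t * v * u) ^ 3 * t := by simp only [pow_succ, pow_zero]; group
    rw [hD, hc] at this
    rw [hD]
    exact mul_right_cancel this

end IsDualSystem

end H3Model

/-! ### The interval below a proper quasi-Coxeter element of order six -/

namespace H3Model

open Equiv CoxeterSystem

theorem cyc_inv_mul_inv_mul_cyc : ∀ i, cyc⁻¹ * inv i * cyc = inv (shift i) := by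
  decide +kernel

theorem inv_spec (i) : Perm.sign (inv i) = 1 ∧ inv i * inv i = 1 ∧ inv i ≠ 1 :=
  (involution_iff _).2 ⟨i, rfl⟩

theorem len_cyc_mul_inv : ∀ i, len (cyc * inv i, 1) = 2 := by
  decide +kernel

theorem map_dual {X Y : Type*} [Group X] [Group Y] (φ : X →* Y) (t u v : X) (i) :
    φ (dual t u v i) = dual (φ t) (φ u) (φ v) i := by
  obtain ⟨o, k⟩ := i
  have hbase : φ (base t u v o) = base (φ t) (φ u) (φ v) o := by
    fin_cases o <;> simp [base]
  simp only [dual, map_mul, map_inv, map_pow, hbase]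

theorem dual_mem {X : Type*} [Group X] (H : Subgroup X) {t u v : X} (ht : t ∈ H) (hu : u ∈ H)
    (hv : v ∈ H) (i) : dual t u v i ∈ H := by
  have h : H.subtype (dual ⟨t, ht⟩ ⟨u, hu⟩ ⟨v, hv⟩ i) = dual t u v i := map_dual _ _ _ _ i
  exact h ▸ SetLike.coe_mem _

variable {W : Type*} [Group W] {cs : CoxeterSystem CoxeterMatrix.H₃ W} {w : W}
  {f : W →* Perm (Fin 5) × ℤˣ}

namespace IsModel

/-- The `i`-th reflection. -/
noncomputable def refl (h : IsModel cs w f) (i : Fin 5 × Fin 3) : W :=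
  (h.surjective (inv i) (-1) (inv_spec i).1).choose

theorem map_refl (h : IsModel cs w f) (i) : f (h.refl i) = (inv i, -1) :=
  (h.surjective (inv i) (-1) (inv_spec i).1).choose_spec

theorem isReflection_refl (h : IsModel cs w f) (i) : cs.IsReflection (h.refl i) :=
  (h.isReflection_iff _).2 (by rw [h.map_refl]; exact ⟨rfl, (inv_spec i).2⟩)

theorem exists_eq_refl (h : IsModel cs w f) {x : W} (hx : cs.IsReflection x) :
    ∃ i, x = h.refl i := by
  obtain ⟨h1, h2⟩ := (h.isReflection_iff x).1 hx
  obtain ⟨i, hi⟩ := (involution_iff _).1 ⟨h.sign_eq x, h2⟩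
  exact ⟨i, h.injective (by rw [h.map_refl]; exact Prod.ext hi.symm h1)⟩

theorem refl_injective (h : IsModel cs w f) : Function.Injective h.refl := fun i j hij =>
  inv_injective i j (by
    have := congrArg f hij
    rw [h.map_refl, h.map_refl] at this
    exact congrArg Prod.fst this)

theorem isDualSystem_refl (h : IsModel cs w f) : IsDualSystem h.refl w where
  conj i := h.injective (by
    rw [map_mul, map_mul, map_inv, h.map_eq, h.map_refl, h.map_refl]
    exact Prod.ext (cyc_inv_mul_inv_mul_cyc i) rfl)
  triple i j k hijk := h.injective (by
    rw [map_mul, map_mul, h.map_eq, h.map_refl, h.map_refl, h.map_refl]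
    exact Prod.ext hijk rfl)

theorem reflLength_refl (h : IsModel cs w f) (i) : cs.reflLength (h.refl i) = 1 := by
  rw [h.reflLength_eq, h.map_refl, len, if_neg (show (-1 : ℤˣ) ≠ 1 by decide),
    if_pos (inv_spec i).2]

theorem reflLength_mul_refl (h : IsModel cs w f) (i) : cs.reflLength (w * h.refl i) = 2 := by
  rw [h.reflLength_eq, map_mul, h.map_eq, h.map_refl]
  exact len_cyc_mul_inv i

theorem reflLength_self (h : IsModel cs w f) : cs.reflLength w = 3 := by
  rw [h.reflLength_eq, h.map_eq]
  decide +kernel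

theorem isReflection_of_reflLength_eq_one {x : W} (hx : cs.reflLength x = 1) :
    cs.IsReflection x := by
  obtain ⟨l, hl, hk⟩ := cs.exists_reduced_reflFactorization x
  rw [hx, List.length_eq_one_iff] at hk
  obtain ⟨t, rfl⟩ := hk
  rw [← hl.2, List.prod_singleton]
  exact hl.1 t (List.mem_singleton_self t)

theorem refl_mul_self (h : IsModel cs w f) (i) : h.refl i * h.refl i = 1 :=
  (h.isReflection_refl i).mul_self

theorem inv_refl (h : IsModel cs w f) (i) : (h.refl i)⁻¹ = h.refl i :=
  (h.isReflection_refl i).inv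

theorem refl_mul_eq (h : IsModel cs w f) (i) : h.refl i * w = w * h.refl (shift i) := by
  rw [← h.isDualSystem_refl.conj]
  group

/-- All reflections lie below `w`. -/
theorem absLE_refl (h : IsModel cs w f) (i) : cs.AbsLE (h.refl i) w := by
  rw [absLE_iff, LengthLE, h.inv_refl, h.refl_mul_eq, h.reflLength_mul_refl, h.reflLength_refl,
    h.reflLength_self]

theorem absLE_mul_refl (h : IsModel cs w f) (i) : cs.AbsLE (w * h.refl i) w := by
  rw [absLE_iff, LengthLE, mul_inv_rev, inv_mul_cancel_right, h.inv_refl, h.reflLength_mul_refl,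
    h.reflLength_refl, h.reflLength_self]

/-- The interval below `w` consists of `1`, of all reflections, of their complements, and of `w`. -/
theorem interval_cases (h : IsModel cs w f) (x : cs.Interval w) :
    x.1 = 1 ∨ (∃ i, x.1 = h.refl i) ∨ (∃ i, x.1 = w * h.refl i) ∨ x.1 = w := by
  have hx := (cs.absLE_iff _ _).1 x.2
  rw [LengthLE, h.reflLength_self] at hx
  have : cs.reflLength x.1 ≤ 3 := by omega
  interval_cases hk : cs.reflLength x.1
  · exact .inl (cs.eq_one_of_reflLength_eq_zero hk)
  · exact .inr (.inl (h.exists_eq_refl (isReflection_of_reflLength_eq_one hk)))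
  · obtain ⟨i, hi⟩ := h.exists_eq_refl (isReflection_of_reflLength_eq_one (by omega :
      cs.reflLength (x.1⁻¹ * w) = 1))
    rw [inv_mul_eq_iff_eq_mul, ← mul_inv_eq_iff_eq_mul, h.inv_refl] at hi
    exact .inr (.inr (.inl ⟨i, hi.symm⟩))
  · have := cs.eq_one_of_reflLength_eq_zero (by omega : cs.reflLength (x.1⁻¹ * w) = 0)
    exact .inr (.inr (.inr (inv_mul_eq_one.1 this)))

/-- A reflection as an element of the interval. -/
noncomputable def atom (h : IsModel cs w f) (i : Fin 5 × Fin 3) : cs.Interval w :=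
  ⟨h.refl i, h.absLE_refl i⟩

/-- The complement of a reflection as an element of the interval. -/
noncomputable def coatom (h : IsModel cs w f) (i : Fin 5 × Fin 3) : cs.Interval w :=
  ⟨w * h.refl i, h.absLE_mul_refl i⟩

end IsModel

/-- The least element of the interval. -/
def intervalBot (cs : CoxeterSystem CoxeterMatrix.H₃ W) (w : W) : cs.Interval w :=
  ⟨1, w, (one_mul w).symm, by rw [cs.reflLength_one, zero_add]⟩

/-- The greatest element of the interval. -/
def intervalTop (cs : CoxeterSystem CoxeterMatrix.H₃ W) (w : W) : cs.Interval w :=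
  ⟨w, 1, (mul_one w).symm, by rw [cs.reflLength_one, add_zero]⟩

namespace IsModel

theorem finite_interval (h : IsModel cs w f) : Finite (cs.Interval w) := by
  have : Finite W := Finite.of_injective f h.injective
  exact Subtype.finite

theorem strictMono_reflLength :
    StrictMono fun x : cs.Interval w => cs.reflLength x.1 := fun x y hxy => by
  obtain ⟨a, ha, hl⟩ : cs.AbsLE x.1 y.1 := hxy.le
  have h0 : cs.reflLength a ≠ 0 := fun h0 => hxy.ne (Subtype.ext (by
    rw [ha, cs.eq_one_of_reflLength_eq_zero h0, mul_one]))
  change cs.reflLength x.1 < cs.reflLength y.1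
  omega

theorem intervalBot_le (x : cs.Interval w) : intervalBot cs w ≤ x :=
  ⟨x.1, (one_mul _).symm, by
    change _ = cs.reflLength 1 + _
    rw [cs.reflLength_one, zero_add]⟩

theorem le_intervalTop (x : cs.Interval w) : x ≤ intervalTop cs w := x.2

/-- Two different reflections have at most one common upper bound of length two below `w`. -/
theorem eq_of_common_upper_bounds (h : IsModel cs w f) (x y z z' : cs.Interval w)
    (hx : cs.reflLength x.1 = 1) (hy : cs.reflLength y.1 = 1) (hz : cs.reflLength z.1 = 2)
    (hz' : cs.reflLength z'.1 = 2) (hxy : x ≠ y) (hxz : x ≤ z) (hyz : y ≤ z) (hxz' : x ≤ z')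
    (hyz' : y ≤ z') : z = z' := by
  have coatom_of : ∀ z : cs.Interval w, cs.reflLength z.1 = 2 → ∃ p, z.1 = w * h.refl p := by
    intro z hz
    rcases h.interval_cases z with h0 | ⟨i, h0⟩ | h0 | h0
    · rw [h0, cs.reflLength_one] at hz; omega
    · rw [h0, h.reflLength_refl] at hz; omega
    · exact h0
    · rw [h0, h.reflLength_self] at hz; omega
  have square : ∀ {x z : cs.Interval w} {i p}, x.1 = h.refl i → z.1 = w * h.refl p → x ≤ z →
      inv i * (cyc * inv p) * (inv i * (cyc * inv p)) = 1 := by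
    intro x z i p hx hz hxz
    have h1 : LengthLE cs.reflLength x.1 z.1 := (cs.absLE_iff _ _).1 hxz
    rw [LengthLE, hx, hz, h.reflLength_refl, h.reflLength_mul_refl, h.inv_refl] at h1
    have := ((h.isReflection_iff _).1 (isReflection_of_reflLength_eq_one (by omega :
      cs.reflLength (h.refl i * (w * h.refl p)) = 1))).2.1
    simpa only [map_mul, h.map_refl, h.map_eq, Prod.fst_mul] using this
  obtain ⟨i, hi⟩ := h.exists_eq_refl (isReflection_of_reflLength_eq_one hx)
  obtain ⟨j, hj⟩ := h.exists_eq_refl (isReflection_of_reflLength_eq_one hy)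
  obtain ⟨p, hp⟩ := coatom_of z hz
  obtain ⟨q, hq⟩ := coatom_of z' hz'
  by_contra hne
  have hpq : p ≠ q := fun hpq => hne (Subtype.ext (by rw [hp, hq, hpq]))
  have := eq_of_common_divisors p i (square hi hp hxz) q hpq (square hi hq hxz') j
    (square hj hp hyz) (square hj hq hyz')
  exact hxy (Subtype.ext (by rw [hi, hj, this]))

theorem exists_isLUB (h : IsModel cs w f) (x y : cs.Interval w) : ∃ z, IsLUB {x, y} z :=
  exists_isLUB_of_rank _ strictMono_reflLength (intervalBot cs w) (intervalTop cs w)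
    intervalBot_le le_intervalTop h.reflLength_self.le h.eq_of_common_upper_bounds x y

theorem exists_isGLB (h : IsModel cs w f) (x y : cs.Interval w) : ∃ z, IsGLB {x, y} z := by
  have le3 : ∀ x : cs.Interval w, cs.reflLength x.1 ≤ 3 := fun x =>
    (strictMono_reflLength.monotone (le_intervalTop x)).trans h.reflLength_self.le
  exact exists_isLUB_of_rank (α := (cs.Interval w)ᵒᵈ)
    (fun x => 3 - cs.reflLength (OrderDual.ofDual x).1)
    (fun x y hxy => by
      have h1 := strictMono_reflLength (OrderDual.ofDual_lt_ofDual.2 hxy)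
      have h2 := le3 (OrderDual.ofDual x)
      dsimp only at h1 ⊢
      omega)
    (OrderDual.toDual (intervalTop cs w)) (OrderDual.toDual (intervalBot cs w))
    le_intervalTop intervalBot_le (Nat.sub_le _ _)
    (fun x y z z' hx hy hz hz' hxy hxz hyz hxz' hyz' => by
      by_contra hne
      have hlen : ∀ {x : cs.Interval w} {k}, 3 - cs.reflLength x.1 = k → cs.reflLength x.1 = 3 - k :=
        fun {x} _ hk => by have := le3 x; omega
      exact hxy (h.eq_of_common_upper_bounds (OrderDual.ofDual z) (OrderDual.ofDual z')
        (OrderDual.ofDual x) (OrderDual.ofDual y) (hlen hz) (hlen hz') (hlen hx) (hlen hy)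
        hne hxz hxz' hyz hyz'))
    (OrderDual.toDual x) (OrderDual.toDual y)

theorem isQuasiCoxeter (h : IsModel cs w f) : cs.IsQuasiCoxeter w := by
  refine ⟨[h.refl (2, 0), h.refl (1, 0), h.refl (0, 0)], ⟨?_, ?_⟩, h.reflLength_self.symm, ?_⟩
  · simp [h.isReflection_refl]
  · simpa [mul_assoc] using h.isDualSystem_refl.mul_eq
  · rw [eq_top_iff, ← cs.subgroup_closure_range_simple, Subgroup.closure_le]
    rintro _ ⟨i, rfl⟩
    obtain ⟨j, hj⟩ := h.exists_eq_refl (cs.isReflection_simple i)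
    rw [hj, congrFun h.isDualSystem_refl.eq_dual j]
    refine dual_mem _ ?_ ?_ ?_ j <;> exact Subgroup.subset_closure (by simp)

theorem orderOf_eq (h : IsModel cs w f) : orderOf w = 6 := by
  rw [← orderOf_injective f h.injective, h.map_eq]
  refine orderOf_eq_of_pow_and_pow_div_prime (by norm_num) (by decide +kernel) fun p hp hd => ?_
  have hp6 : p ≤ 6 := Nat.le_of_dvd (by norm_num) hd
  interval_cases p <;> revert hp hd <;> norm_num
  all_goals decide +kernel

end IsModel

/-- The proper quasi-Coxeter elements of order `6` form the conjugacy class of an element with an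
adapted model. -/
theorem isH3a2_iff (h : IsModel cs w f) (hw : ¬ cs.IsCoxeterElement w) (x : W) :
    H3a2.IsH3a2 cs x ↔ IsConj w x := by
  constructor
  · rintro ⟨-, hx⟩
    rw [← orderOf_injective f h.injective] at hx
    have h6 := pow_orderOf_eq_one (f x)
    have h2 := pow_ne_one_of_lt_orderOf (x := f x) (n := 2) (by norm_num) (by omega)
    have h3 := pow_ne_one_of_lt_orderOf (x := f x) (n := 3) (by norm_num) (by omega)
    rw [hx] at h6
    have hsq : (f x).1 ^ 2 ≠ 1 := fun hs => h2 (Prod.ext hs (Int.units_sq _))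
    obtain ⟨h3', τ, hτ, hc⟩ := exists_conj_cyc _ (h.sign_eq x) (congrArg Prod.fst h6) hsq
    have he : (f x).2 = -1 := (Int.units_eq_one_or _).resolve_left fun he =>
      h3 (Prod.ext h3' (by rw [Prod.pow_snd, he]; rfl))
    obtain ⟨g, hg⟩ := h.surjective τ 1 hτ
    refine isConj_iff.2 ⟨g, h.injective ?_⟩
    rw [map_mul, map_mul, map_inv, hg, h.map_eq]
    exact Prod.ext hc (by rw [he]; rfl)
  · intro hx
    obtain ⟨g, rfl⟩ := isConj_iff.1 hx
    exact ⟨⟨h.isQuasiCoxeter.conj g, fun hc => hw (hc.of_isConj hx.symm)⟩, (h.conj g).orderOf_eq⟩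

end H3Model

/-! ### The presentation of the interval group -/

namespace H3Model

open Equiv CoxeterSystem

/-- The relators of the triangle presentation evaluate to `1` exactly at solutions of its
relations. -/
theorem triangleRelations_iff {X : Type*} [Group X] (s : Fin 3 → X) :
    (∀ r ∈ H3a2.relators, FreeGroup.lift s r = 1) ↔ TriangleRelations (s 0) (s 1) (s 2) := by
  have hM : ∀ i j, H3a2.triangle i j = !![1, 3, 3; 3, 1, 5; 3, 5, 1] i j := fun i j => rfl
  have hbraid : ∀ i j, FreeGroup.lift s
      (((alternatingWord i j (H3a2.triangle i j)).map FreeGroup.of).prod *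
        ((alternatingWord j i (H3a2.triangle i j)).map FreeGroup.of).prod⁻¹) = 1 ↔
      ((alternatingWord i j (H3a2.triangle i j)).map s).prod =
        ((alternatingWord j i (H3a2.triangle i j)).map s).prod := fun i j => by
    rw [map_mul, map_inv, mul_inv_eq_one, map_list_prod, map_list_prod, List.map_map, List.map_map]
    simp only [Function.comp_def, FreeGroup.lift_apply_of]
  have h4 : FreeGroup.lift s ((H3a2.s₂ * H3a2.s₃ * H3a2.s₂ * H3a2.s₁ * H3a2.s₃ * H3a2.s₂) *
      (H3a2.s₃ * H3a2.s₂ * H3a2.s₁ * H3a2.s₃ * H3a2.s₂ * H3a2.s₃)⁻¹) = 1 ↔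
      s 1 * s 2 * s 1 * s 0 * s 2 * s 1 = s 2 * s 1 * s 0 * s 2 * s 1 * s 2 := by
    rw [map_mul, map_inv, mul_inv_eq_one]
    simp only [map_mul, H3a2.s₁, H3a2.s₂, H3a2.s₃, FreeGroup.lift_apply_of]
  have h5 : FreeGroup.lift s ((H3a2.s₃ * H3a2.s₂ * H3a2.s₁) ^ 3 *
      ((H3a2.s₁ * H3a2.s₃ * H3a2.s₂) ^ 3)⁻¹) = 1 ↔
      (s 2 * s 1 * s 0) ^ 3 = (s 0 * s 2 * s 1) ^ 3 := by
    rw [map_mul, map_inv, mul_inv_eq_one]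
    simp only [map_mul, map_pow, H3a2.s₁, H3a2.s₂, H3a2.s₃, FreeGroup.lift_apply_of]
  constructor
  · intro h
    have hb := fun i j => (hbraid i j).1 (h _ (.inl ⟨i, j, rfl⟩))
    have b01 := hb 1 0
    have b02 := hb 2 0
    have b12 := hb 2 1
    simp [hM, alternatingWord] at b01 b02 b12
    exact ⟨by simpa only [mul_assoc] using b01, by simpa only [mul_assoc] using b02,
      by simpa only [mul_assoc] using b12, h4.1 (h _ (.inr (.inl rfl))),
      h5.1 (h _ (.inr (.inr rfl)))⟩
  · rintro h r (⟨i, j, rfl⟩ | rfl | rfl)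
    · rw [hbraid]
      have b01 := h.braid_tu
      have b02 := h.braid_tv
      have b12 := h.braid_uv
      simp only [mul_assoc] at b01 b02 b12
      fin_cases i <;> fin_cases j <;> simp [hM, alternatingWord, b01, b02, b12]
    · exact h4.2 h.conj_u
    · exact h5.2 h.cube

variable {W : Type*} [Group W] {cs : CoxeterSystem CoxeterMatrix.H₃ W} {w : W}
  {f : W →* Perm (Fin 5) × ℤˣ}

theorem of_intervalBot : (PresentedGroup.of (intervalBot cs w) : cs.IntervalGroup w) = 1 := by
  have : (PresentedGroup.of (intervalBot cs w) * PresentedGroup.of (intervalBot cs w) :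
      cs.IntervalGroup w) = _ := cs.of_mul_of (z := intervalBot cs w) (mul_one _) (by
    change cs.reflLength 1 = cs.reflLength 1 + cs.reflLength 1
    rw [cs.reflLength_one])
  rwa [mul_eq_left] at this

namespace IsModel

theorem of_coatom_mul (h : IsModel cs w f) (i) :
    (PresentedGroup.of (h.coatom i) * PresentedGroup.of (h.atom i) : cs.IntervalGroup w) =
      PresentedGroup.of (intervalTop cs w) :=
  cs.of_mul_of (by
    change w * h.refl i * h.refl i = w
    rw [mul_assoc, h.refl_mul_self, mul_one])
    (by
      change cs.reflLength w = cs.reflLength (w * h.refl i) + cs.reflLength (h.refl i)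
      rw [h.reflLength_self, h.reflLength_mul_refl, h.reflLength_refl])

theorem of_mul_coatom (h : IsModel cs w f) (i) :
    (PresentedGroup.of (h.atom i) * PresentedGroup.of (h.coatom (shift i)) : cs.IntervalGroup w) =
      PresentedGroup.of (intervalTop cs w) :=
  cs.of_mul_of (by
    change h.refl i * (w * h.refl (shift i)) = w
    rw [← h.refl_mul_eq, ← mul_assoc, h.refl_mul_self, one_mul])
    (by
      change cs.reflLength w = cs.reflLength (h.refl i) + cs.reflLength (w * h.refl (shift i))
      rw [h.reflLength_self, h.reflLength_mul_refl, h.reflLength_refl])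

/-- The reflections in the interval group form a dual system. -/
theorem isDualSystem_of (h : IsModel cs w f) :
    IsDualSystem (fun i => (PresentedGroup.of (h.atom i) : cs.IntervalGroup w))
      (PresentedGroup.of (intervalTop cs w)) where
  conj i := by
    rw [mul_assoc, inv_mul_eq_iff_eq_mul]
    nth_rw 1 [← h.of_coatom_mul (shift i)]
    rw [← mul_assoc, h.of_mul_coatom]
  triple i j k hijk := by
    have hw : h.refl i * h.refl j * h.refl k = w := h.isDualSystem_refl.triple i j k hijk
    have hw' : h.refl i * h.refl j = w * h.refl k := by
      rw [← mul_inv_eq_iff_eq_mul, h.inv_refl, hw]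
    rw [cs.of_mul_of (z := h.coatom k) hw', h.of_coatom_mul]
    change cs.reflLength (w * h.refl k) = cs.reflLength (h.refl i) + cs.reflLength (h.refl j)
    rw [h.reflLength_mul_refl, h.reflLength_refl, h.reflLength_refl]

/-- A dual system in a group defines a homomorphism from the interval group. -/
theorem exists_hom (h : IsModel cs w f) {X : Type*} [Group X] {T : Fin 5 × Fin 3 → X} {D : X}
    (hT : IsDualSystem T D) :
    ∃ F : cs.IntervalGroup w →* X, ∀ i, F (PresentedGroup.of (h.atom i)) = T i := by
  have l0 := cs.reflLength_one
  have l1 := h.reflLength_refl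
  have l2 := h.reflLength_mul_refl
  have l3 := h.reflLength_self
  have ne : ∀ {x y : W}, cs.reflLength x ≠ cs.reflLength y → x ≠ y := fun hl hxy =>
    hl (congrArg _ hxy)
  have hg : ∀ x : cs.Interval w, ∃ a : X, (x.1 = 1 → a = 1) ∧ (∀ i, x.1 = h.refl i → a = T i) ∧
      (∀ i, x.1 = w * h.refl i → a = D * (T i)⁻¹) ∧ (x.1 = w → a = D) := by
    intro x
    rcases h.interval_cases x with hx | ⟨i, hx⟩ | ⟨i, hx⟩ | hx
    · exact ⟨1, fun _ => rfl, fun i hi => absurd (hx.symm.trans hi) (ne (by rw [l0, l1]; omega)),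
        fun i hi => absurd (hx.symm.trans hi) (ne (by rw [l0, l2]; omega)),
        fun hi => absurd (hx.symm.trans hi) (ne (by rw [l0, l3]; omega))⟩
    · exact ⟨T i, fun hi => absurd (hx.symm.trans hi) (ne (by rw [l0, l1]; omega)),
        fun j hj => by rw [h.refl_injective (hx.symm.trans hj)],
        fun i hi => absurd (hx.symm.trans hi) (ne (by rw [l1, l2]; omega)),
        fun hi => absurd (hx.symm.trans hi) (ne (by rw [l1, l3]; omega))⟩
    · exact ⟨D * (T i)⁻¹, fun hi => absurd (hx.symm.trans hi) (ne (by rw [l0, l2]; omega)),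
        fun i hi => absurd (hx.symm.trans hi) (ne (by rw [l1, l2]; omega)),
        fun j hj => by rw [h.refl_injective (mul_left_cancel (hx.symm.trans hj))],
        fun hi => absurd (hx.symm.trans hi) (ne (by rw [l2, l3]; omega))⟩
    · exact ⟨D, fun hi => absurd (hx.symm.trans hi) (ne (by rw [l0, l3]; omega)),
        fun i hi => absurd (hx.symm.trans hi) (ne (by rw [l1, l3]; omega)),
        fun i hi => absurd (hx.symm.trans hi) (ne (by rw [l2, l3]; omega)), fun _ => rfl⟩
  choose g g0 g1 g2 g3 using hg
  have g_eq : ∀ {x y : cs.Interval w}, x.1 = y.1 → g x = g y := fun hxy => by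
    rw [Subtype.ext hxy]
  have le3 : ∀ x : cs.Interval w, cs.reflLength x.1 ≤ 3 := fun x =>
    (strictMono_reflLength.monotone (le_intervalTop x)).trans l3.le
  refine ⟨PresentedGroup.toGroup (f := g) ?_, fun i => ?_⟩
  · rintro _ ⟨x, y, z, hz, hl, rfl⟩
    simp only [map_mul, map_inv, FreeGroup.lift_apply_of, mul_inv_eq_one]
    have hz3 := le3 z
    rcases h.interval_cases x with hx | ⟨i, hx⟩ | ⟨i, hx⟩ | hx
    · rw [hx, one_mul] at hz
      rw [g0 x hx, one_mul, g_eq hz]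
    · rcases h.interval_cases y with hy | ⟨j, hy⟩ | ⟨j, hy⟩ | hy
      · rw [hy, mul_one] at hz
        rw [g0 y hy, mul_one, g_eq hz]
      · rw [hx, hy, l1, l1] at hl
        rcases h.interval_cases z with hk | ⟨k, hk⟩ | ⟨k, hk⟩ | hk
        · rw [hk, l0] at hl; omega
        · rw [hk, l1] at hl; omega
        · rw [g1 x i hx, g1 y j hy, g2 z k hk, eq_mul_inv_iff_mul_eq]
          refine hT.triple i j k ?_
          rw [hx, hy, hk, ← h.inv_refl k, eq_mul_inv_iff_mul_eq] at hz
          have := congrArg (fun x => (f x).1) hz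
          simpa only [map_mul, h.map_refl, h.map_eq, Prod.fst_mul] using this
        · rw [hk, l3] at hl; omega
      · rw [hx, hy, l1, l2] at hl
        rw [hx, hy, ← mul_assoc, h.refl_mul_eq, mul_assoc] at hz
        have hzw : z.1 = w := by
          rcases h.interval_cases z with hk | ⟨k, hk⟩ | ⟨k, hk⟩ | hk
          · rw [hk, l0] at hl; omega
          · rw [hk, l1] at hl; omega
          · rw [hk, l2] at hl; omega
          · exact hk
        rw [hzw, mul_eq_left, mul_eq_one_iff_eq_inv, h.inv_refl] at hz
        rw [g1 x i hx, g2 y j hy, g3 z hzw, ← h.refl_injective hz, ← hT.conj]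
        group
      · rw [hx, hy, l1, l3] at hl; omega
    · rcases h.interval_cases y with hy | ⟨j, hy⟩ | ⟨j, hy⟩ | hy
      · rw [hy, mul_one] at hz
        rw [g0 y hy, mul_one, g_eq hz]
      · rw [hx, hy, l1, l2] at hl
        have hzw : z.1 = w := by
          rcases h.interval_cases z with hk | ⟨k, hk⟩ | ⟨k, hk⟩ | hk
          · rw [hk, l0] at hl; omega
          · rw [hk, l1] at hl; omega
          · rw [hk, l2] at hl; omega
          · exact hk
        rw [hx, hy, hzw, mul_assoc, mul_eq_left, mul_eq_one_iff_eq_inv, h.inv_refl] at hz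
        rw [g2 x i hx, g1 y j hy, g3 z hzw, h.refl_injective hz, inv_mul_cancel_right]
      · rw [hx, hy, l2, l2] at hl; omega
      · rw [hx, hy, l2, l3] at hl; omega
    · rcases h.interval_cases y with hy | ⟨j, hy⟩ | ⟨j, hy⟩ | hy
      · rw [hy, mul_one] at hz
        rw [g0 y hy, mul_one, g_eq hz]
      · rw [hx, hy, l1, l3] at hl; omega
      · rw [hx, hy, l2, l3] at hl; omega
      · rw [hx, hy, l3] at hl; omega
  · rw [PresentedGroup.toGroup.of, g1 _ i rfl]

/-- The three reflections that generate the interval group. -/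
noncomputable def generators (h : IsModel cs w f) : Fin 3 → cs.Interval w :=
  ![h.atom (0, 0), h.atom (1, 0), h.atom (2, 0)]

theorem isReflection_generators (h : IsModel cs w f) (i) : cs.IsReflection (h.generators i).1 := by
  fin_cases i <;> exact h.isReflection_refl _

/-- Both groups are universal among groups with a dual system, which is determined by three of its
members. -/
theorem exists_mulEquiv (h : IsModel cs w f) :
    ∃ e : PresentedGroup H3a2.relators ≃* cs.IntervalGroup w,
      ∀ i, e (PresentedGroup.of i) = PresentedGroup.of (h.generators i) := by
  have hrel : TriangleRelations (PresentedGroup.of 0 : PresentedGroup H3a2.relators)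
      (PresentedGroup.of 1) (PresentedGroup.of 2) := by
    refine (triangleRelations_iff PresentedGroup.of).1 fun r hr => ?_
    have : FreeGroup.lift PresentedGroup.of = PresentedGroup.mk H3a2.relators :=
      FreeGroup.ext_hom _ _ fun i => by rw [FreeGroup.lift_apply_of]; rfl
    rw [this]
    exact PresentedGroup.one_of_mem hr
  obtain ⟨G, hG⟩ := h.exists_hom hrel.isDualSystem
  have hdual := h.isDualSystem_of
  let F : PresentedGroup H3a2.relators →* cs.IntervalGroup w :=
    PresentedGroup.toGroup (f := fun i => PresentedGroup.of (h.generators i))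
      ((triangleRelations_iff _).2 hdual.triangleRelations)
  have hF : ∀ i, F (PresentedGroup.of i) = PresentedGroup.of (h.generators i) := fun i =>
    PresentedGroup.toGroup.of _
  have hatom : ∀ i, F (G (PresentedGroup.of (h.atom i))) = PresentedGroup.of (h.atom i) := by
    intro i
    rw [hG, map_dual, hF, hF, hF]
    exact (congrFun hdual.eq_dual i).symm
  have htop : F (G (PresentedGroup.of (intervalTop cs w))) =
      PresentedGroup.of (intervalTop cs w) := by
    rw [← hdual.mul_eq, map_mul, map_mul, map_mul, map_mul, hatom, hatom, hatom]
  refine ⟨MonoidHom.toMulEquiv F G ?_ ?_, hF⟩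
  · refine PresentedGroup.ext fun i => ?_
    change G (F (PresentedGroup.of i)) = PresentedGroup.of i
    rw [hF]
    fin_cases i
    · exact (hG (0, 0)).trans (by simp [dual, base])
    · exact (hG (1, 0)).trans (by simp [dual, base])
    · exact (hG (2, 0)).trans (by simp [dual, base])
  · refine PresentedGroup.ext fun x => ?_
    change F (G (PresentedGroup.of x)) = PresentedGroup.of x
    rcases h.interval_cases x with hx | ⟨i, hx⟩ | ⟨i, hx⟩ | hx
    · rw [show x = intervalBot cs w from Subtype.ext hx, of_intervalBot, map_one, map_one]
    · rw [show x = h.atom i from Subtype.ext hx, hatom]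
    · rw [show x = h.coatom i from Subtype.ext hx, eq_mul_inv_of_mul_eq (h.of_coatom_mul i),
        map_mul, map_mul, map_inv, map_inv, hatom, htop]
    · rw [show x = intervalTop cs w from Subtype.ext hx, htop]

end IsModel

end H3Model

/-! ### The Artin group of type `H₃` -/

namespace H3Model

open Matrix CoxeterSystem

/-- The five-dimensional irreducible representation of the Hecke algebra of type `H₃` at `q = 2`
over the field with `11` elements. Its `W`-graph is a path whose vertices have the descent sets
`{0, 2}`, `{1}`, `{2}`, `{1}`, `{0}`. -/
def hecke : Fin 3 → Matrix (Fin 5) (Fin 5) (ZMod 11) :=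
  ![!![-1, 2, 0, 0, 0; 0, 2, 0, 0, 0; 0, 0, 2, 0, 0; 0, 0, 0, 2, 0; 0, 0, 0, 2, -1],
    !![2, 0, 0, 0, 0; 1, -1, 1, 0, 0; 0, 0, 2, 0, 0; 0, 0, 1, -1, 1; 0, 0, 0, 0, 2],
    !![-1, 2, 0, 0, 0; 0, 2, 0, 0, 0; 0, 2, -1, 2, 0; 0, 0, 0, 2, 0; 0, 0, 0, 0, 2]]

theorem hecke_braid_zero_one : hecke 0 * hecke 1 * hecke 0 = hecke 1 * hecke 0 * hecke 1 := by
  decide +kernel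

theorem hecke_commute_zero_two : hecke 0 * hecke 2 = hecke 2 * hecke 0 := by
  decide +kernel

theorem hecke_braid_one_two : hecke 1 * hecke 2 * hecke 1 * hecke 2 * hecke 1 =
    hecke 2 * hecke 1 * hecke 2 * hecke 1 * hecke 2 := by
  decide +kernel

theorem det_hecke : ∀ i, (hecke i).det = 8 := by
  decide +kernel

/-- The representation is absolutely irreducible: its commutant consists of the scalars. -/
theorem eq_smul_one_of_commute_hecke {Z : Matrix (Fin 5) (Fin 5) (ZMod 11)}
    (hZ : ∀ i, Z * hecke i = hecke i * Z) : Z = Z 0 0 • (1 : Matrix (Fin 5) (Fin 5) (ZMod 11)) := by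
  have h3 : ∀ x : ZMod 11, -x = 2 * x → x = 0 := by decide
  have h3' : ∀ x : ZMod 11, x * 2 = -x → x = 0 := by decide
  have h2 : ∀ x y : ZMod 11, x * 2 = 2 * y → y = x := by decide
  have entry : ∀ i a b, (Z * hecke i) a b = (hecke i * Z) a b := fun i a b => by rw [hZ]
  simp only [Matrix.mul_apply, Fin.sum_univ_five] at entry
  have z10 : Z 1 0 = 0 := h3 _ (by simpa [hecke] using entry 0 1 0)
  have z20 : Z 2 0 = 0 := h3 _ (by simpa [hecke] using entry 0 2 0)
  have z30 : Z 3 0 = 0 := h3 _ (by simpa [hecke] using entry 0 3 0)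
  have z14 : Z 1 4 = 0 := h3 _ (by simpa [hecke] using entry 0 1 4)
  have z24 : Z 2 4 = 0 := h3 _ (by simpa [hecke] using entry 0 2 4)
  have z34 : Z 3 4 = 0 := h3 _ (by simpa [hecke] using entry 0 3 4)
  have z01 : Z 0 1 = 0 := h3 _ (by simpa [hecke] using entry 1 0 1)
  have z21 : Z 2 1 = 0 := h3 _ (by simpa [hecke] using entry 1 2 1)
  have z41 : Z 4 1 = 0 := h3 _ (by simpa [hecke] using entry 1 4 1)
  have z03 : Z 0 3 = 0 := h3 _ (by simpa [hecke] using entry 1 0 3)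
  have z23 : Z 2 3 = 0 := h3 _ (by simpa [hecke] using entry 1 2 3)
  have z43 : Z 4 3 = 0 := h3 _ (by simpa [hecke] using entry 1 4 3)
  have z40 : Z 4 0 = 0 := h3 _ (by simpa [hecke] using entry 2 4 0)
  have z12 : Z 1 2 = 0 := h3 _ (by simpa [hecke] using entry 2 1 2)
  have z32 : Z 3 2 = 0 := h3 _ (by simpa [hecke] using entry 2 3 2)
  have z42 : Z 4 2 = 0 := h3 _ (by simpa [hecke] using entry 2 4 2)
  have z02 : Z 0 2 = 0 := h3' _ (by simpa [hecke, z12] using entry 0 0 2)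
  have z04 : Z 0 4 = 0 := h3' _ (by simpa [hecke, z14] using entry 2 0 4)
  have z13 : Z 1 3 = 0 := by simpa [hecke, z14, z04, z24] using entry 1 1 4
  have z31 : Z 3 1 = 0 := by simpa [hecke, z30, z20, z40] using entry 1 3 0
  have d1 : Z 1 1 = Z 0 0 := h2 _ _ (by simpa [hecke, z01] using entry 0 0 1)
  have d2 : Z 2 2 = Z 1 1 := (by simpa [hecke, z12, z13, z02] using entry 1 1 2 : Z 1 1 = Z 2 2).symm
  have d3 : Z 3 3 = Z 2 2 := by simpa [hecke, z31, z32, z42] using entry 1 3 2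
  have d4 : Z 4 4 = Z 3 3 := (by simpa [hecke, z34, z24] using entry 1 3 4 : Z 3 3 = Z 4 4).symm
  have offdiag : ∀ a b, a ≠ b → Z a b = 0 := by
    intro a b hab
    fin_cases a <;> fin_cases b <;> first | exact absurd rfl hab | assumption
  have diag : ∀ a, Z a a = Z 0 0 := by
    intro a
    fin_cases a
    exacts [rfl, d1, d2.trans d1, d3.trans (d2.trans d1), d4.trans (d3.trans (d2.trans d1))]
  ext a b
  rw [Matrix.smul_apply, Matrix.one_apply, smul_eq_mul]
  split_ifs with hab
  · rw [← hab, diag, mul_one]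
  · rw [offdiag a b hab, mul_zero]

theorem exists_hecke_hom : ∃ ρ : CoxeterMatrix.H₃.ArtinGroup →* (Matrix (Fin 5) (Fin 5) (ZMod 11))ˣ,
    ∀ i, (ρ (PresentedGroup.of i)).val = hecke i := by
  have hunit : ∀ i, IsUnit (hecke i) := fun i => by
    rw [Matrix.isUnit_iff_isUnit_det, det_hecke]
    decide +kernel
  choose s hs using hunit
  have h01 : s 0 * s 1 * s 0 = s 1 * s 0 * s 1 := Units.ext (by
    simpa only [Units.val_mul, hs] using hecke_braid_zero_one)
  have h02 : s 0 * s 2 = s 2 * s 0 := Units.ext (by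
    simpa only [Units.val_mul, hs] using hecke_commute_zero_two)
  have h12 : s 1 * s 2 * s 1 * s 2 * s 1 = s 2 * s 1 * s 2 * s 1 * s 2 := Units.ext (by
    simpa only [Units.val_mul, hs] using hecke_braid_one_two)
  simp only [mul_assoc] at h01 h12
  refine ⟨PresentedGroup.toGroup (f := s) ?_, fun i => by rw [PresentedGroup.toGroup.of, hs]⟩
  rintro _ ⟨i, j, rfl⟩
  rw [map_mul, map_inv, mul_inv_eq_one, map_list_prod, map_list_prod, List.map_map, List.map_map]
  simp only [Function.comp_def, FreeGroup.lift_apply_of]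
  fin_cases i <;> fin_cases j <;>
    simp [CoxeterMatrix.H₃, alternatingWord, h01, h02, h12]

theorem eq_of_braid {A : Type*} [CommGroup A] {a b : A} (h : a * b * a = b * a * b) : b = a := by
  rw [mul_comm a b] at h
  exact (mul_left_cancel h).symm

/-- A group generated by solutions of the triangle relations is not the Artin group of type `H₃`.
It has the central element `(v u t) ^ 3`, a product of nine generators, which would act on the
five-dimensional representation by a scalar `a`; so the ninth power of the determinant of a
generator would be `a ^ 5`, which has order at most `2`. But the determinants of the generators of
the Artin group have order `10`. -/
theorem isEmpty_mulEquiv_artinGroup {X : Type*} [Group X] {t u v : X}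
    (h : TriangleRelations t u v) (hgen : Subgroup.closure {t, u, v} = ⊤) :
    IsEmpty (X ≃* CoxeterMatrix.H₃.ArtinGroup) := by
  refine ⟨fun φ => ?_⟩
  obtain ⟨ρ, hρ⟩ := exists_hecke_hom
  let χ : X →* (ZMod 11)ˣ := (Units.map Matrix.detMonoidHom).comp (ρ.comp φ.toMonoidHom)
  have hχ : ∀ x, (χ x).val = (ρ (φ x)).val.det := fun x => by
    simp only [χ, MonoidHom.comp_apply, Units.coe_map, Matrix.coe_detMonoidHom,
      MulEquiv.coe_toMonoidHom]
  have hut : χ u = χ t := by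
    have := congrArg χ h.braid_tu
    simp only [map_mul] at this
    exact eq_of_braid this
  have hvt : χ v = χ t := by
    have := congrArg χ h.braid_tv
    simp only [map_mul] at this
    exact eq_of_braid this
  have hmem : ∀ x, χ x ∈ Subgroup.zpowers (χ t) := fun x => by
    have hle : Subgroup.closure {t, u, v} ≤ (Subgroup.zpowers (χ t)).comap χ := by
      rw [Subgroup.closure_le]
      rintro _ (rfl | rfl | rfl)
      · exact Subgroup.mem_zpowers _
      · exact hut ▸ Subgroup.mem_zpowers _
      · exact hvt ▸ Subgroup.mem_zpowers _
    exact hle (hgen ▸ Subgroup.mem_top x)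
  have hcentral : ∀ x, Commute ((v * u * t) ^ 3) x := fun x => by
    have hle : Subgroup.closure {t, u, v} ≤ Subgroup.centralizer {(v * u * t) ^ 3} := by
      rw [Subgroup.closure_le]
      rintro _ (rfl | rfl | rfl) <;>
        simp only [SetLike.mem_coe, Subgroup.mem_centralizer_singleton_iff]
      exacts [h.commute_t.symm, h.commute_u.symm, h.commute_v.symm]
    exact (Subgroup.mem_centralizer_singleton_iff.1 (hle (hgen ▸ Subgroup.mem_top x))).symm
  obtain ⟨a, ha⟩ : ∃ a : ZMod 11, (ρ (φ ((v * u * t) ^ 3))).val =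
      a • (1 : Matrix (Fin 5) (Fin 5) (ZMod 11)) := by
    refine ⟨_, eq_smul_one_of_commute_hecke fun i => ?_⟩
    have := congrArg (fun x => (ρ (φ x)).val) (hcentral (φ.symm (PresentedGroup.of i))).eq
    simpa only [map_mul, Units.val_mul, MulEquiv.apply_symm_apply, hρ] using this
  have h9 : ((χ t).val) ^ 9 = a ^ 5 := by
    have := hχ ((v * u * t) ^ 3)
    rw [ha, Matrix.det_smul, Matrix.det_one, mul_one, Fintype.card_fin] at this
    rw [← this, map_pow, map_mul, map_mul, hut, hvt]
    push_cast
    ring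
  have : Fact (Nat.Prime 11) := ⟨by norm_num⟩
  have h18 : χ t ^ 18 = 1 := Units.ext (by
    have ha0 : a ≠ 0 := fun h0 => by
      rw [h0, zero_pow (by norm_num)] at h9
      exact (χ t).ne_zero (eq_zero_of_pow_eq_zero h9)
    have := ZMod.pow_card_sub_one_eq_one ha0
    rw [Units.val_pow_eq_pow_val, show 18 = 9 * 2 from rfl, pow_mul, h9, ← pow_mul]
    exact this)
  obtain ⟨n, hn⟩ := hmem (φ.symm (PresentedGroup.of 0))
  have h8 : χ (φ.symm (PresentedGroup.of 0)) ^ 18 = 1 := by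
    rw [← hn]
    change ((χ t) ^ n) ^ 18 = 1
    rw [← zpow_natCast, ← _root_.zpow_mul, mul_comm, _root_.zpow_mul, zpow_natCast, h18,
      _root_.one_zpow]
  have := congrArg Units.val h8
  rw [Units.val_pow_eq_pow_val, hχ, MulEquiv.apply_symm_apply, hρ, det_hecke] at this
  revert this
  decide +kernel

end H3Model

theorem mainTheorem5 {W : Type*} [Group W] (cs : CoxeterSystem CoxeterMatrix.H₃ W) :
    -- the elements `H₃(a₂)` exist and form exactly one conjugacy class
    (∃ w₀ : W, ∀ w : W, H3a2.IsH3a2 cs w ↔ IsConj w₀ w) ∧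
    ∀ w : W, H3a2.IsH3a2 cs w →
      -- the presentation, with the three generators corresponding to reflections in `[1, w]`
      (∃ (t : Fin 3 → cs.Interval w)
          (e : PresentedGroup H3a2.relators ≃* cs.IntervalGroup w),
        (∀ i, cs.IsReflection (t i).1) ∧
        ∀ i, e (PresentedGroup.of i) = PresentedGroup.of (t i)) ∧
      -- the interval is a lattice
      (∀ x y : cs.Interval w,
        (∃ z, IsLUB {x, y} z) ∧ ∃ z, IsGLB {x, y} z) ∧
      -- the interval group is a Garside group, not isomorphic to the Artin group of type `H₃`
      IsGarsideGroup (cs.IntervalGroup w) ∧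
      IsEmpty (cs.IntervalGroup w ≃* CoxeterMatrix.H₃.ArtinGroup) := by
  obtain ⟨w₀, f₀, h₀, hw₀⟩ := H3Model.exists_isModel cs
  refine ⟨⟨w₀, H3Model.isH3a2_iff h₀ hw₀⟩, fun w hw => ?_⟩
  obtain ⟨g, rfl⟩ := isConj_iff.1 ((H3Model.isH3a2_iff h₀ hw₀ w).1 hw)
  have h := h₀.conj g
  have := h.finite_interval
  obtain ⟨e, he⟩ := h.exists_mulEquiv
  refine ⟨⟨h.generators, e, h.isReflection_generators, he⟩,
    fun x y => ⟨h.exists_isLUB x y, h.exists_isGLB x y⟩,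
    cs.isGarsideGroup_intervalGroup _ h.exists_isLUB,
    H3Model.isEmpty_mulEquiv_artinGroup h.isDualSystem_of.triangleRelations ?_⟩
  have hmap := congrArg (Subgroup.map e.toMonoidHom)
    (PresentedGroup.closure_range_of H3a2.relators)
  rw [MonoidHom.map_closure, Subgroup.map_top_of_surjective _ e.surjective] at hmap
  rw [eq_top_iff, ← hmap, Subgroup.closure_le]
  rintro _ ⟨_, ⟨i, rfl⟩, rfl⟩
  refine Subgroup.subset_closure ?_
  change e (PresentedGroup.of i) ∈ _
  rw [he]
  fin_cases i
  exacts [.inl rfl, .inr (.inl rfl), .inr (.inr rfl)]
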